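/- **Setting.** Let $d\ge 1$, let $V:\mathbb R^d\to\mathbb R$, let $W:\mathbb R^d\times\mathbb R^d\to(-\infty,+\infty]$, and let $(\beta_N)_N$ be positive real numbers with $\beta_N\gg N\log N$, that is, $\beta_N/(N\log N)\to+\infty$. Let $|\cdot|$ be the Euclidean norm, and let $\mathcal M_1$ be the set of Borel probability measures on $\mathbb R^d$ with the weak topology. Conventions: $\log 0=-\infty$, $e^{-\infty}=0$, $\inf\varnothing=+\infty$. Assume: * **(H1)** $W$ is continuous as a map into $(-\infty,+\infty]$, symmetric, finite off the diagonal, and for every compact $K\subset\mathbb R^d$ the function $z\mapsto\sup\{W(x,y):\ |x-y|\ge|z|,\ x,y\in K\}$ (read as $0$ where the supremum is over the empty set) is locally Lebesgue-integrable on $\mathbb R^d$. * **(H2)** $V$ is continuous, $V(x)\to+\infty$ as $|x|\to\infty$, and $\int_{\mathbb R^d} e^{-V(x)}\,dx<\infty$. * **(H3)** There are $c\in\mathbb R$ and $\varepsilon_o\in(0,1)$ with $W(x,y)\ge c-\varepsilon_o(V(x)+V(y))$ for all $x,y$. For $x=(x_1,\dots,x_N)\in(\mathbb R^d)^N$ put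 $$H_N(x)=\frac1N\sum_{i=1}^N V(x_i)+\frac1{N^2}\sum_{i<j}W(x_i,x_j),\qquad Z_N=\int_{(\mathbb R^d)^N}e^{-\beta_NH_N(x)}\,dx,\qquad dP_N(x)=\frac{e^{-\beta_NH_N(x)}}{Z_N}\,dx,$$ and $\mu_N=\frac1N\sum_{i=1}^N\delta_{x_i}\in\mathcal M_1$. For $\mu\in\mathcal M_1$ put $$I(\mu)=\frac12\iint\bigl(V(x)+V(y)+W(x,y)\bigr)\,d\mu(x)\,d\mu(y)\in(-\infty,+\infty],\qquad I_\star=I-\inf_{\mathcal M_1}I,\qquad I_{\min}=\{I_\star=0\}.$$ Consider also the assumption * **(H4)** For every $\nu\in\mathcal M_1$ with $I(\nu)<\infty$ there are $\nu_n\in\mathcal M_1$, absolutely continuous with respect to Lebesgue measure, with $\nu_n\to\nu$ weakly and $I(\nu_n)\to I(\nu)$. Let $d_{\mathrm{FM}}(\mu,\nu)=\sup\{\int f\,d\mu-\int f\,d\nu:\ |f|\le1,\ f\ 1\text{-Lipschitz}\}$ and $d_{\mathrm{FM}}(\mu,S)=\inf_{\nu\in S}d_{\mathrm{FM}}(\mu,\nu)$.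 **Theorem 1.1 (Large deviations principle).** Under (H1)–(H3) and $\beta_N\gg N\log N$, one has $0<Z_N<\infty$ for all large $N$, so that $P_N$ is then a probability measure, and: 1. For every $k\in\mathbb R$ the level set $\{I\le k\}$ is compact in $\mathcal M_1$, $I$ is lower semicontinuous, and $\inf_{\mathcal M_1}I>-\infty$. 2. For every Borel set $A\subset\mathcal M_1$, $$\limsup_{N\to\infty}\frac{\log\bigl(Z_NP_N(\mu_N\in A)\bigr)}{\beta_N}\le-\inf_{\mu\in\operatorname{clo}(A)}I(\mu),$$ $$\liminf_{N\to\infty}\frac{\log\bigl(Z_NP_N(\mu_N\in A)\bigr)}{\beta_N}\ge-\inf\{I(\mu):\ \mu\in\operatorname{int}(A),\ \mu\ll\mathrm{Lebesgue}\}.$$ 3. If (H4) also holds, then for every Borel set $A\subset\mathcal M_1$, $$-\inf_{\operatorname{int}(A)}I_\star\le\liminf_{N\to\infty}\frac{\log P_N(\mu_N\in A)}{\beta_N}\le\limsup_{N\to\infty}\frac{\log P_N(\mu_N\in A)}{\beta_N}\le-\inf_{\operatorname{clo}(A)}I_\star,$$ and $\displaystyle\lim_{N\to\infty}\frac{\log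 Z_N}{\beta_N}=-\inf_{\mathcal M_1}I$. 4. $I_{\min}\ne\varnothing$. If (H4) also holds and the random measures $\mu_N$ are constructed on a common probability space in any way such that, for all large $N$, $\mu_N$ has the law of the empirical measure under $P_N$, then almost surely $\displaystyle\lim_{N\to\infty}d_{\mathrm{FM}}(\mu_N,I_{\min})=0$. -/

import Mathlib

open MeasureTheory Filter Topology
open scoped ENNReal

namespace ParticleGas

noncomputable section

/-- The space `ℝ^d` with its Euclidean norm. -/
abbrev Space (d : ℕ) : Type := EuclideanSpace ℝ (Fin d)

/-- `ℳ₁(ℝ^d)`, the Borel probability measures on `ℝ^d`, with the weak topology. -/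
abbrev Prob (d : ℕ) : Type := ProbabilityMeasure (Space d)

/-- The integral in `[-∞, +∞]` of an extended real valued function: integral of the positive part
minus integral of the negative part. It is the usual one as soon as one of the two is finite, in
particular for measurable functions bounded from below and finite measures. -/
def erealIntegral {α : Type*} [MeasurableSpace α] (μ : Measure α) (f : α → EReal) : EReal :=
  ((∫⁻ x, (f x).toENNReal ∂μ : ℝ≥0∞) : EReal) - ((∫⁻ x, (-(f x)).toENNReal ∂μ : ℝ≥0∞) : EReal)

/-- `sup {W(x,y) ; |x - y| ≥ |z|, x, y ∈ K}`. -/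
def supAway {d : ℕ} (W : Space d → Space d → EReal) (K : Set (Space d)) (z : Space d) : EReal :=
  sSup {w : EReal | ∃ x ∈ K, ∃ y ∈ K, ‖z‖ ≤ ‖x - y‖ ∧ w = W x y}

/-- Assumption (H1) on the interaction `W : ℝ^d × ℝ^d → (-∞, +∞]`. In the last field `toReal` only
sets to `0` the value `-∞` (for `z` larger than the diameter of `K`, where the supremum is over the
empty set) and the value `+∞` (which can only occur at the single point `z = 0`). -/
structure H1 {d : ℕ} (W : Space d → Space d → EReal) : Prop where
  ne_bot : ∀ x y, W x y ≠ ⊥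
  continuous : Continuous fun p : Space d × Space d => W p.1 p.2
  symm : ∀ x y, W x y = W y x
  ne_top : ∀ x y, x ≠ y → W x y ≠ ⊤
  locallyIntegrable : ∀ K : Set (Space d), IsCompact K →
    LocallyIntegrable (fun z => (supAway W K z).toReal) volume

/-- Assumption (H2) on the external field `V`. -/
structure H2 {d : ℕ} (V : Space d → ℝ) : Prop where
  continuous : Continuous V
  tendsto : Tendsto V (cocompact (Space d)) atTop
  integrable : Integrable (fun x => Real.exp (-V x)) volume

/-- Assumption (H3): `V` dominates `W` at infinity. -/
def H3 {d : ℕ} (V : Space d → ℝ) (W : Space d → Space d → EReal) : Prop :=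
  ∃ c ε : ℝ, 0 < ε ∧ ε < 1 ∧ ∀ x y, ((c - ε * (V x + V y) : ℝ) : EReal) ≤ W x y

/-- The functional `I(μ) = ½ ∬ (V(x) + V(y) + W(x,y)) dμ(x) dμ(y)`. -/
def energy {d : ℕ} (V : Space d → ℝ) (W : Space d → Space d → EReal) (μ : Prob d) : EReal :=
  ((1 / 2 : ℝ) : EReal) *
    erealIntegral ((μ : Measure (Space d)).prod (μ : Measure (Space d)))
      (fun p => ((V p.1 + V p.2 : ℝ) : EReal) + W p.1 p.2)

/-- `I⋆ = I - inf I`. -/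
def rate {d : ℕ} (V : Space d → ℝ) (W : Space d → Space d → EReal) (μ : Prob d) : EReal :=
  energy V W μ - ⨅ ν : Prob d, energy V W ν

/-- `I_min = {I⋆ = 0}`. -/
def minimizers {d : ℕ} (V : Space d → ℝ) (W : Space d → Space d → EReal) : Set (Prob d) :=
  {μ | rate V W μ = 0}

/-- Assumption (H4): approximation by absolutely continuous measures, with their energy. -/
def H4 {d : ℕ} (V : Space d → ℝ) (W : Space d → Space d → EReal) : Prop :=
  ∀ ν : Prob d, energy V W ν < ⊤ → ∃ νs : ℕ → Prob d,
    (∀ n, (νs n : Measure (Space d)) ≪ volume) ∧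
    Tendsto νs atTop (𝓝 ν) ∧
    Tendsto (fun n => energy V W (νs n)) atTop (𝓝 (energy V W ν))

/-- The energy `H_N(x₁,…,x_N) = N⁻¹ ∑ᵢ V(xᵢ) + N⁻² ∑_{i<j} W(xᵢ,xⱼ)` of a configuration. -/
def hamiltonian {d : ℕ} (V : Space d → ℝ) (W : Space d → Space d → EReal) (N : ℕ)
    (x : Fin N → Space d) : EReal :=
  (((1 / (N : ℝ)) * ∑ i, V (x i) : ℝ) : EReal) +
    ((1 / (N : ℝ) ^ 2 : ℝ) : EReal) *
      ∑ p ∈ (Finset.univ : Finset (Fin N × Fin N)).filter (fun p => p.1 < p.2), W (x p.1) (x p.2)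

/-- `exp(-b H_N(x))`, equal to `0` where `H_N(x) = +∞`. -/
def weight {d : ℕ} (V : Space d → ℝ) (W : Space d → Space d → EReal) (b : ℝ) (N : ℕ)
    (x : Fin N → Space d) : ℝ≥0∞ :=
  EReal.exp (-((b : EReal) * hamiltonian V W N x))

/-- The partition function `Z_N = ∫ exp(-b H_N(x)) dx₁ ⋯ dx_N`, with `b = β_N`. -/
def partitionFn {d : ℕ} (V : Space d → ℝ) (W : Space d → Space d → EReal) (b : ℝ) (N : ℕ) :
    ℝ≥0∞ :=
  ∫⁻ x : Fin N → Space d, weight V W b N x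

/-- The Boltzmann–Gibbs measure `P_N` on `(ℝ^d)^N`, a probability measure if `0 < Z_N < ∞`. -/
def gibbs {d : ℕ} (V : Space d → ℝ) (W : Space d → Space d → EReal) (b : ℝ) (N : ℕ) :
    Measure (Fin N → Space d) :=
  volume.withDensity fun x => weight V W b N x / partitionFn V W b N

theorem isProbabilityMeasure_average {d N : ℕ} (hN : N ≠ 0) (x : Fin N → Space d) :
    IsProbabilityMeasure ((N : ℝ≥0∞)⁻¹ • ∑ i, Measure.dirac (x i)) := by
  constructor
  simp only [Measure.smul_apply, Measure.finsetSum_apply, measure_univ, Finset.sum_const,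
    Finset.card_univ, Fintype.card_fin, smul_eq_mul, nsmul_eq_mul, mul_one]
  exact ENNReal.inv_mul_cancel (by exact_mod_cast hN) (ENNReal.natCast_ne_top N)

/-- The empirical measure `μ_N = N⁻¹ ∑ᵢ δ_{xᵢ}` of a configuration of `N ≥ 1` points
(with an arbitrary value for `N = 0`). -/
def empirical {d N : ℕ} (x : Fin N → Space d) : Prob d :=
  if hN : N = 0 then ⟨Measure.dirac 0, inferInstance⟩
  else ⟨(N : ℝ≥0∞)⁻¹ • ∑ i, Measure.dirac (x i), isProbabilityMeasure_average hN x⟩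

/-- `P_N(μ_N ∈ A)`. -/
def empiricalProb {d : ℕ} (V : Space d → ℝ) (W : Space d → Space d → EReal) (b : ℝ) (N : ℕ)
    (A : Set (Prob d)) : ℝ≥0∞ :=
  gibbs V W b N {x | empirical x ∈ A}

/-- The Fortet–Mourier (bounded Lipschitz) distance. -/
def dFM {d : ℕ} (μ ν : Prob d) : ℝ :=
  sSup {r : ℝ | ∃ f : Space d → ℝ, (∀ x, |f x| ≤ 1) ∧ LipschitzWith 1 f ∧
    r = (∫ x, f x ∂(μ : Measure (Space d))) - ∫ x, f x ∂(ν : Measure (Space d))}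

/-- The Fortet–Mourier distance to a (nonempty) set of probability measures. -/
def dFMSet {d : ℕ} (μ : Prob d) (S : Set (Prob d)) : ℝ :=
  sInf ((fun ν => dFM μ ν) '' S)

end

end ParticleGas

/-! By (H3), `V(x) + V(y) + W(x,y)` is bounded below by a constant `b` plus a positive multiple of
`V(x) + V(y) - 2 min V`. After subtraction of `b`, the energy is half the integral of a nonnegative
continuous kernel, the gap, against `μ ⊗ μ`, and `H_N` is the corresponding sum over pairs up to
`O(1/N)` and a small remnant of `∑ V`. Truncated at level `n`, the gap gives a weakly continuous
functional. The energy is the supremum over `n`, hence lower semicontinuous; coercivity of `V` gives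
tightness, hence compact level sets.

Upper bound: configurations of bounded `H_N` have empirical measures in one compact set, where a
single truncation exceeds any level below the infimum of `I`. The truncation sees the diagonal of
the empirical measure only up to `n/N`, so `H_N` exceeds that level too
(`eventually_le_hamiltonian`). A portion `N/κ` of `β_N` is spent on making the weight integrable,
which costs nothing since `N/β_N → 0` (`weight_le`).

Lower bound: for `μ` with density at most `B` and `V` bounded `μ`-a.s., an i.i.d. sample has
empirical measure near `μ` with probability tending to one, and energy below `k > I(μ)` with
probability bounded away from zero (Markov suffices). Such configurations have Lebesgue volume at
least a constant times `B^{-N}`, negligible at speed `β_N` (`exists_le_lintegral_weight`).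
Conditioning reduces absolutely continuous measures to this case, and (H4) removes absolute
continuity.

With (H4), `log Z_N / β_N` converges to a finite limit, which turns the bounds into the principle
for `P_N`. Almost sure convergence is Borel–Cantelli; only there does `β_N` have to beat `log N`. -/

namespace ParticleGas

/-! ### The energy as the integral of a nonnegative kernel -/

/-- `½ t + ½ b` as an extended real number. -/
noncomputable def halfShift (b : ℝ) (t : ℝ≥0∞) : EReal :=
  ((2⁻¹ * t : ℝ≥0∞) : EReal) + ((b / 2 : ℝ) : EReal)

/-- The excess of `V(x) + V(y) + W(x,y)` over the constant `b`. -/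
noncomputable def gap {d : ℕ} (V : Space d → ℝ) (W : Space d → Space d → EReal) (b : ℝ)
    (p : Space d × Space d) : ℝ≥0∞ :=
  (((V p.1 + V p.2 - b : ℝ) : EReal) + W p.1 p.2).toENNReal

/-- The sum of the gaps of all pairs of a configuration. -/
noncomputable def gapSum {d : ℕ} (V : Space d → ℝ) (W : Space d → Space d → EReal) (b : ℝ)
    {N : ℕ} (x : Fin N → Space d) : ℝ≥0∞ :=
  ∑ p ∈ (Finset.univ : Finset (Fin N × Fin N)).filter (fun p => p.1 < p.2),
    gap V W b (x p.1, x p.2)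

/-- The standing assumptions, with normalized constants. -/
structure Confined {d : ℕ} (V : Space d → ℝ) (W : Space d → Space d → EReal)
    (m b κ : ℝ) : Prop where
  hV : H2 V
  hW : H1 W
  lower : ∀ x, m ≤ V x
  κ_pos : 0 < κ
  κ_lt : κ < 1
  coercive : ∀ x y, ((b + κ * ((V x - m) + (V y - m)) - (V x + V y) : ℝ) : EReal) ≤ W x y

theorem continuous_halfShift (b : ℝ) : Continuous (halfShift b) := by
  unfold halfShift
  refine continuous_iff_continuousAt.2 fun t => ?_
  have h1 : ContinuousAt (fun t : ℝ≥0∞ => ((2⁻¹ * t : ℝ≥0∞) : EReal)) t :=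
    (continuous_coe_ennreal_ereal.comp (ENNReal.continuous_const_mul (by simp))).continuousAt
  exact ContinuousAt.comp (f := fun t : ℝ≥0∞ => (((2⁻¹ * t : ℝ≥0∞) : EReal), ((b / 2 : ℝ) : EReal)))
    (g := fun p : EReal × EReal => p.1 + p.2)
    (EReal.continuousAt_add (by simp) (by simp)) (h1.prodMk continuousAt_const)

theorem monotone_halfShift (b : ℝ) : Monotone (halfShift b) := by
  intro s t h
  unfold halfShift
  gcongr
  exact_mod_cast (by gcongr : 2⁻¹ * s ≤ 2⁻¹ * t)

theorem halfShift_top (b : ℝ) : halfShift b ⊤ = ⊤ := by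
  simp [halfShift, ENNReal.mul_top]

theorem halfShift_ofReal (b : ℝ) {t : ℝ} (ht : 0 ≤ t) :
    halfShift b (ENNReal.ofReal t) = ((t / 2 + b / 2 : ℝ) : EReal) := by
  have : (2⁻¹ : ℝ≥0∞) = ENNReal.ofReal (2⁻¹) := by
    rw [ENNReal.ofReal_inv_of_pos (by norm_num)]; simp
  rw [halfShift, this, ← ENNReal.ofReal_mul (by norm_num), EReal.coe_ennreal_ofReal,
    max_eq_left (by positivity), ← EReal.coe_add]
  congr 1; ring

theorem halfShift_lt_top_iff (b : ℝ) {t : ℝ≥0∞} : halfShift b t < ⊤ ↔ t < ⊤ := by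
  constructor
  · intro h
    by_contra h'
    rw [not_lt_top_iff.1 h', halfShift_top] at h
    exact lt_irrefl _ h
  · intro h
    lift t to NNReal using h.ne
    rw [← ENNReal.ofReal_coe_nnreal, halfShift_ofReal b t.coe_nonneg]
    exact EReal.coe_lt_top _

/-- Pointwise `f⁺ + b⁻ = g + f⁻ + b⁺`, an identity between nonnegative quantities that can be
integrated without subtraction. Since `f⁻ ≤ b⁻`, the subtracted integral is finite and can be moved
back afterwards. -/
theorem erealIntegral_eq {α : Type*} [MeasurableSpace α] (μ : Measure α) [IsProbabilityMeasure μ]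
    {f : α → EReal} {g : α → ℝ≥0∞} (hg : Measurable g) (b : ℝ)
    (hf : ∀ x, f x = (g x : EReal) + (b : EReal)) :
    erealIntegral μ f = ((∫⁻ x, g x ∂μ : ℝ≥0∞) : EReal) + (b : EReal) := by
  have hfm : Measurable f := by
    have : f = fun x => (g x : EReal) + (b : EReal) := funext hf
    rw [this]
    exact (measurable_coe_ennreal_ereal.comp hg).add_const _
  have key : ∀ x, (f x).toENNReal + ENNReal.ofReal (-b)
      = g x + (-(f x)).toENNReal + ENNReal.ofReal b := by
    intro x
    rw [hf x]
    induction hgx : g x using ENNReal.recTopCoe with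
    | top => simp
    | coe t =>
      have h1 : (((t : ℝ≥0∞) : EReal) + (b : EReal)) = ((t + b : ℝ) : EReal) := by
        push_cast; rfl
      rw [h1, ← EReal.coe_neg, EReal.toENNReal_of_ne_top (EReal.coe_ne_top _),
        EReal.toENNReal_of_ne_top (EReal.coe_ne_top _), EReal.toReal_coe, EReal.toReal_coe]
      have h2 : (t : ℝ≥0∞) = ENNReal.ofReal t := (ENNReal.ofReal_coe_nnreal).symm
      rw [h2]
      have ht := t.coe_nonneg
      rcases le_total 0 b with hb | hb <;> rcases le_total 0 (t + b : ℝ) with hc | hc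
      · rw [ENNReal.ofReal_of_nonpos (p := -b) (by linarith),
          ENNReal.ofReal_of_nonpos (p := -(t + b : ℝ)) (by linarith), ENNReal.ofReal_add ht hb]
        simp
      · have : b = 0 := by
          have : (0:ℝ) ≤ t := ht
          linarith
        have h0 : (t : ℝ) = 0 := by
          have : (0:ℝ) ≤ t := ht
          linarith
        simp [this, h0]
      · rw [ENNReal.ofReal_of_nonpos hb,
          ENNReal.ofReal_of_nonpos (p := -(t + b : ℝ)) (by linarith),
          ← ENNReal.ofReal_add hc (by linarith)]
        simp
      · rw [ENNReal.ofReal_of_nonpos hb, ENNReal.ofReal_of_nonpos hc,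
          ← ENNReal.ofReal_add ht (by linarith)]
        simp
  have hneg : ∫⁻ x, (-(f x)).toENNReal ∂μ ≠ ⊤ := by
    refine ne_top_of_le_ne_top (b := ENNReal.ofReal (-b)) ENNReal.ofReal_ne_top ?_
    calc ∫⁻ x, (-(f x)).toENNReal ∂μ ≤ ∫⁻ _, ENNReal.ofReal (-b) ∂μ := by
          refine lintegral_mono fun x => ?_
          have : -(f x) ≤ ((-b : ℝ) : EReal) := by
            rw [hf x, EReal.coe_neg, EReal.neg_le_neg_iff]
            exact le_add_of_nonneg_left (EReal.coe_ennreal_nonneg _)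
          calc (-(f x)).toENNReal ≤ ((-b : ℝ) : EReal).toENNReal := EReal.toENNReal_le_toENNReal this
            _ = _ := by
              rw [EReal.toENNReal_of_ne_top (EReal.coe_ne_top _), EReal.toReal_coe]
      _ = _ := by simp
  have hint : ∫⁻ x, (f x).toENNReal ∂μ + ENNReal.ofReal (-b)
      = ∫⁻ x, g x ∂μ + ∫⁻ x, (-(f x)).toENNReal ∂μ + ENNReal.ofReal b := by
    have := lintegral_congr (μ := μ) key
    rw [lintegral_add_right _ measurable_const, lintegral_add_right _ measurable_const,
      lintegral_add_left hg] at this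
    simpa using this
  unfold erealIntegral
  generalize ∫⁻ x, (f x).toENNReal ∂μ = P at *
  generalize ∫⁻ x, (-(f x)).toENNReal ∂μ = Q at *
  generalize ∫⁻ x, g x ∂μ = G at *
  lift Q to NNReal using hneg
  by_cases hG : G = ⊤
  · have hP : P = ⊤ := by
      by_contra h
      rw [hG] at hint
      simp at hint
      exact h hint
    rw [hG, hP]
    rfl
  · have hP : P ≠ ⊤ := by
      intro h
      rw [h, top_add] at hint
      have := ENNReal.add_ne_top.2 ⟨ENNReal.add_ne_top.2 ⟨hG, ENNReal.coe_ne_top (r := Q)⟩,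
        ENNReal.ofReal_ne_top (r := b)⟩
      exact this hint.symm
    lift P to NNReal using hP
    lift G to NNReal using hG
    have h3 := congrArg ENNReal.toReal hint
    rw [ENNReal.toReal_add (by simp) (by simp), ENNReal.toReal_add (by simp) (by simp),
      ENNReal.toReal_add (by simp) (by simp)] at h3
    simp only [ENNReal.coe_toReal, ENNReal.toReal_ofReal'] at h3
    have h4 : max b 0 - max (-b) 0 = b := by
      rcases le_total 0 b with hb | hb
      · rw [max_eq_left hb, max_eq_right (by linarith)]; ring
      · rw [max_eq_right hb, max_eq_left (by linarith)]; ring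
    change ((P : ℝ) : EReal) - ((Q : ℝ) : EReal) = ((G : ℝ) : EReal) + (b : EReal)
    rw [← EReal.coe_sub, ← EReal.coe_add]
    congr 1
    linarith

variable {d : ℕ} {V : Space d → ℝ} {W : Space d → Space d → EReal} {m b κ : ℝ}

namespace Confined

/-- Coercivity makes the shifted kernel nonnegative, so `toENNReal` in `gap` discards nothing. -/
theorem gap_add (h : Confined V W m b κ) (x y : Space d) :
    ((V x + V y : ℝ) : EReal) + W x y = (gap V W b (x, y) : EReal) + (b : EReal) := by
  have hc := h.coercive x y
  have hv : 0 ≤ κ * ((V x - m) + (V y - m)) := by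
    have := h.lower x; have := h.lower y; have := h.κ_pos
    apply mul_nonneg <;> linarith
  have hpos : 0 ≤ ((V x + V y - b : ℝ) : EReal) + W x y := by
    calc (0 : EReal) ≤ ((V x + V y - b : ℝ) : EReal)
          + ((b + κ * ((V x - m) + (V y - m)) - (V x + V y) : ℝ) : EReal) := by
          rw [← EReal.coe_add]; exact_mod_cast (by linarith)
      _ ≤ _ := by gcongr
  rw [gap, EReal.coe_toENNReal hpos, add_right_comm, ← EReal.coe_add]
  congr 2; ring

theorem gap_ge (h : Confined V W m b κ) (x y : Space d) :
    ENNReal.ofReal (κ * ((V x - m) + (V y - m))) ≤ gap V W b (x, y) := by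
  have hc := h.coercive x y
  have : ((κ * ((V x - m) + (V y - m)) : ℝ) : EReal) ≤ ((V x + V y - b : ℝ) : EReal) + W x y := by
    calc _ = ((V x + V y - b : ℝ) : EReal)
          + ((b + κ * ((V x - m) + (V y - m)) - (V x + V y) : ℝ) : EReal) := by
          rw [← EReal.coe_add]; congr 1; ring
      _ ≤ _ := by gcongr
  have := EReal.toENNReal_le_toENNReal this
  rwa [EReal.toENNReal_of_ne_top (EReal.coe_ne_top _), EReal.toReal_coe] at this

theorem continuous_gap (h : Confined V W m b κ) : Continuous (gap V W b) := by
  unfold gap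
  refine EReal.continuous_toENNReal.comp ?_
  refine continuous_iff_continuousAt.2 fun p => ?_
  have h1 : Continuous fun p : Space d × Space d => ((V p.1 + V p.2 - b : ℝ) : EReal) :=
    continuous_coe_real_ereal.comp
      (((h.hV.continuous.comp continuous_fst).add (h.hV.continuous.comp continuous_snd)).sub
        continuous_const)
  exact ContinuousAt.comp
    (f := fun p : Space d × Space d => (((V p.1 + V p.2 - b : ℝ) : EReal), W p.1 p.2))
    (g := fun p : EReal × EReal => p.1 + p.2)
    (EReal.continuousAt_add (Or.inl (EReal.coe_ne_top _)) (Or.inl (EReal.coe_ne_bot _)))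
    (h1.continuousAt.prodMk h.hW.continuous.continuousAt)

theorem gap_symm (h : Confined V W m b κ) (x y : Space d) :
    gap V W b (x, y) = gap V W b (y, x) := by
  simp only [gap, h.hW.symm x y, add_comm (V x) (V y)]

theorem energy_eq (h : Confined V W m b κ) (μ : Prob d) :
    energy V W μ = halfShift b
      (∫⁻ p, gap V W b p ∂((μ : Measure (Space d)).prod (μ : Measure (Space d)))) := by
  rw [energy, erealIntegral_eq _ h.continuous_gap.measurable b (fun p => h.gap_add p.1 p.2),
    halfShift, EReal.left_distrib_of_nonneg_of_ne_top (by exact_mod_cast (by norm_num : (0:ℝ) ≤ 1/2))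
      (EReal.coe_ne_top _), ← EReal.coe_mul, EReal.coe_ennreal_mul]
  congr 2
  · rw [← ENNReal.ofReal_ofNat, ← ENNReal.ofReal_inv_of_pos (by norm_num), EReal.coe_ennreal_ofReal]
    norm_num
  · ring

end Confined

/-! ### The Hamiltonian as a sum of gaps -/

theorem sum_filter_lt_add {N : ℕ} (v : Fin N → ℝ) :
    ∑ p ∈ (Finset.univ : Finset (Fin N × Fin N)).filter (fun p => p.1 < p.2), (v p.1 + v p.2)
      = (N - 1) * ∑ i, v i := by
  have h1 : ∑ p ∈ (Finset.univ : Finset (Fin N × Fin N)).filter (fun p => p.1 < p.2), v p.2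
      = ∑ p ∈ (Finset.univ : Finset (Fin N × Fin N)).filter (fun p => p.2 < p.1), v p.1 :=
    Finset.sum_bij' (fun p _ => p.swap) (fun p _ => p.swap) (by simp) (by simp) (by simp) (by simp)
      (by simp)
  have h2 : ∑ p : Fin N × Fin N, v p.1
      = ∑ p ∈ (Finset.univ : Finset (Fin N × Fin N)).filter (fun p => p.1 < p.2), v p.1
      + ∑ p ∈ (Finset.univ : Finset (Fin N × Fin N)).filter (fun p => p.2 < p.1), v p.1
      + ∑ i, v i := by
    have h3 : ∀ p : Fin N × Fin N, v p.1 = (if p.1 < p.2 then v p.1 else 0)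
        + (if p.2 < p.1 then v p.1 else 0) + (if p.1 = p.2 then v p.1 else 0) := by
      intro p
      rcases lt_trichotomy p.1 p.2 with h | h | h
      · simp [h, h.not_gt, h.ne]
      · simp [h]
      · simp [h, h.not_gt, h.ne']
    rw [Finset.sum_congr rfl fun p _ => h3 p, Finset.sum_add_distrib, Finset.sum_add_distrib,
      Finset.sum_filter, Finset.sum_filter]
    congr 1
    rw [Fintype.sum_prod_type]
    simp
  rw [Finset.sum_add_distrib, h1]
  rw [Fintype.sum_prod_type] at h2
  simp only [Finset.sum_const, Finset.card_univ, Fintype.card_fin, nsmul_eq_mul,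
    ← Finset.mul_sum] at h2
  linarith

theorem two_mul_card_filter_lt (N : ℕ) :
    2 * (((Finset.univ : Finset (Fin N × Fin N)).filter (fun p => p.1 < p.2)).card : ℝ)
      = (N - 1) * N := by
  have := sum_filter_lt_add (fun _ : Fin N => (1 : ℝ))
  simp at this
  linarith

theorem ereal_sum_coe_add_coe {ι : Type*} (s : Finset ι) (g : ι → ℝ≥0∞) (r : ι → ℝ) :
    ∑ i ∈ s, ((g i : EReal) + (r i : EReal))
      = ((∑ i ∈ s, g i : ℝ≥0∞) : EReal) + ((∑ i ∈ s, r i : ℝ) : EReal) := by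
  classical
  induction s using Finset.induction_on with
  | empty => simp
  | insert a s ha ih =>
    rw [Finset.sum_insert ha, Finset.sum_insert ha, Finset.sum_insert ha, ih, EReal.coe_add,
      EReal.coe_ennreal_add]
    abel

namespace Confined

/-- Each point lies in `N - 1` pairs, so the gaps absorb the share `(N - 1)/N²` of `V(xᵢ)`; of the
weight `1/N` there remains `1/N²`. -/
theorem hamiltonian_eq (h : Confined V W m b κ) {N : ℕ} (hN : N ≠ 0) (x : Fin N → Space d) :
    hamiltonian V W N x
      = ((ENNReal.ofReal (1 / (N : ℝ) ^ 2) * gapSum V W b x : ℝ≥0∞) : EReal)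
        + ((b * (N - 1) / (2 * N) + (∑ i, V (x i)) / (N : ℝ) ^ 2 : ℝ) : EReal) := by
  have hN' : (N : ℝ) ≠ 0 := by exact_mod_cast hN
  have hW : ∀ p : Fin N × Fin N, W (x p.1) (x p.2) = (gap V W b (x p.1, x p.2) : EReal)
      + ((b - (V (x p.1) + V (x p.2)) : ℝ) : EReal) := by
    intro p
    have := h.gap_add (x p.1) (x p.2)
    have h2 : W (x p.1) (x p.2) = ((V (x p.1) + V (x p.2) : ℝ) : EReal) + W (x p.1) (x p.2)
        - ((V (x p.1) + V (x p.2) : ℝ) : EReal) := EReal.add_sub_cancel_left.symm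
    rw [h2, this, sub_eq_add_neg, ← EReal.coe_neg, add_assoc, ← EReal.coe_add]
    rfl
  rw [hamiltonian, Finset.sum_congr rfl fun p _ => hW p, ereal_sum_coe_add_coe,
    EReal.left_distrib_of_nonneg_of_ne_top (by exact_mod_cast (by positivity))
      (EReal.coe_ne_top _), ← EReal.coe_mul, EReal.coe_ennreal_mul, EReal.coe_ennreal_ofReal,
    max_eq_left (by positivity), add_left_comm, ← EReal.coe_add]
  congr 2
  rw [Finset.sum_sub_distrib, sum_filter_lt_add (fun i => V (x i)), Finset.sum_const, nsmul_eq_mul]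
  have := two_mul_card_filter_lt N
  have h5 : (((Finset.univ : Finset (Fin N × Fin N)).filter (fun p => p.1 < p.2)).card : ℝ)
      = (N - 1) * N / 2 := by linarith
  rw [h5]
  field_simp
  ring

end Confined

/-! ### Lower semicontinuity, tightness and compact level sets -/

/-- The double integral of the gap, truncated at level `n`. -/
noncomputable def truncGap (V : Space d → ℝ) (W : Space d → Space d → EReal) (b : ℝ) (n : ℕ)
    (μ : Prob d) : ℝ≥0∞ :=
  ∫⁻ p, min (gap V W b p) n ∂((μ : Measure (Space d)).prod (μ : Measure (Space d)))

namespace Confined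

/-- The truncated gap is a bounded continuous test function, and `μ ↦ μ ⊗ μ` is weakly continuous.
-/
theorem continuous_truncGap (h : Confined V W m b κ) (n : ℕ) : Continuous (truncGap V W b n) := by
  have hc : Continuous fun p => (min (gap V W b p) n).toNNReal := by
    refine ENNReal.continuousOn_toNNReal.comp_continuous
      (h.continuous_gap.min continuous_const) fun p => ?_
    exact ne_top_of_le_ne_top (ENNReal.natCast_ne_top n) (min_le_right _ _)
  let f : BoundedContinuousFunction (Space d × Space d) NNReal :=
    BoundedContinuousFunction.mkOfBound ⟨_, hc⟩ (n : ℝ) (by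
      intro x y
      have hb : ∀ p, (min (gap V W b p) n).toNNReal ≤ (n : NNReal) := fun p =>
        (ENNReal.toNNReal_mono (ENNReal.natCast_ne_top n) (min_le_right _ _)).trans (by simp)
      have h1 : (((min (gap V W b x) n).toNNReal : NNReal) : ℝ) ≤ n := by exact_mod_cast hb x
      have h2 : (((min (gap V W b y) n).toNNReal : NNReal) : ℝ) ≤ n := by exact_mod_cast hb y
      have h3 := ((min (gap V W b x) n).toNNReal).coe_nonneg
      have h4 := ((min (gap V W b y) n).toNNReal).coe_nonneg
      rw [NNReal.dist_eq, abs_le]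
      exact ⟨by simp only [ContinuousMap.coe_mk]; linarith,
        by simp only [ContinuousMap.coe_mk]; linarith⟩)
  have h1 := (ProbabilityMeasure.continuous_lintegral_boundedContinuousFunction f).comp
    ((ProbabilityMeasure.continuous_prod (α := Space d) (β := Space d)).comp
      (continuous_id.prodMk continuous_id))
  convert h1 using 1
  funext μ
  refine lintegral_congr fun p => ?_
  exact (ENNReal.coe_toNNReal
    (ne_top_of_le_ne_top (ENNReal.natCast_ne_top n) (min_le_right _ _))).symm

theorem iSup_truncGap (h : Confined V W m b κ) (μ : Prob d) :
    ⨆ n, truncGap V W b n μ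
      = ∫⁻ p, gap V W b p ∂((μ : Measure (Space d)).prod (μ : Measure (Space d))) := by
  unfold truncGap
  rw [← lintegral_iSup (fun n => h.continuous_gap.measurable.min measurable_const)]
  · refine lintegral_congr fun p => ?_
    rw [← inf_iSup_eq, ENNReal.iSup_natCast, inf_top_eq]
  · intro i j hij p
    exact min_le_min_left _ (by exact_mod_cast hij)

theorem monotone_truncGap (μ : Prob d) : Monotone fun n => truncGap V W b n μ := by
  intro i j hij
  exact lintegral_mono fun p => min_le_min_left _ (by exact_mod_cast hij)

theorem tendsto_truncGap (h : Confined V W m b κ) (μ : Prob d) :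
    Tendsto (fun n => halfShift b (truncGap V W b n μ)) atTop (𝓝 (energy V W μ)) := by
  rw [h.energy_eq, ← h.iSup_truncGap]
  exact ((continuous_halfShift b).tendsto _).comp (tendsto_atTop_iSup (monotone_truncGap μ))

theorem lowerSemicontinuous_energy (h : Confined V W m b κ) :
    LowerSemicontinuous (energy V W) := by
  have h1 : energy V W = halfShift b ∘ fun μ => ⨆ n, truncGap V W b n μ := by
    funext μ
    rw [h.energy_eq, ← h.iSup_truncGap]; rfl
  rw [h1]
  exact (continuous_halfShift b).comp_lowerSemicontinuous
    (lowerSemicontinuous_iSup fun n => (h.continuous_truncGap n).lowerSemicontinuous)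
    (monotone_halfShift b)

theorem le_energy (h : Confined V W m b κ) (μ : Prob d) :
    ((b / 2 : ℝ) : EReal) ≤ energy V W μ := by
  rw [h.energy_eq, halfShift]
  exact le_add_of_nonneg_left (EReal.coe_ennreal_nonneg _)

/-- Markov's inequality and the growth of `V` at infinity give tightness; Prokhorov's theorem
concludes. -/
theorem isCompact_closure_confined (h : Confined V W m b κ) (C : ℝ) :
    IsCompact (closure {μ : Prob d |
      ∫⁻ x, ENNReal.ofReal (V x - m) ∂(μ : Measure (Space d)) ≤ ENNReal.ofReal C}) := by
  refine isCompact_closure_of_isTightMeasureSet ?_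
  rw [isTightMeasureSet_iff_exists_isCompact_measure_compl_le]
  intro δ hδ
  by_cases hδt : δ = ⊤
  · exact ⟨∅, isCompact_empty, by simp [hδt]⟩
  have hδ' : 0 < δ.toReal := ENNReal.toReal_pos hδ.ne' hδt
  set C' := max C 0
  obtain ⟨R, hR⟩ : ∃ R : ℝ, C' / δ.toReal < R ∧ 0 < R :=
    ⟨max (C' / δ.toReal) 0 + 1, by have := le_max_left (C' / δ.toReal) 0; linarith,
      by have := le_max_right (C' / δ.toReal) 0; linarith⟩
  have hcoc := (h.hV.tendsto.eventually_ge_atTop (m + R))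
  obtain ⟨K, hK, hKsub⟩ := mem_cocompact.1 hcoc
  refine ⟨K, hK, ?_⟩
  rintro _ ⟨μ, hμ, rfl⟩
  have hm : Measurable fun x => ENNReal.ofReal (V x - m) :=
    (h.hV.continuous.measurable.sub_const _).ennreal_ofReal
  have hle := mul_meas_ge_le_lintegral (μ := (μ : Measure (Space d))) hm (ENNReal.ofReal R)
  have hsub : Kᶜ ⊆ {x | ENNReal.ofReal R ≤ ENNReal.ofReal (V x - m)} := by
    intro x hx
    have := hKsub hx
    simp only [Set.mem_ofPred_eq] at this ⊢
    exact ENNReal.ofReal_le_ofReal (by linarith)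
  have h2 : ENNReal.ofReal R * (μ : Measure (Space d)) Kᶜ ≤ ENNReal.ofReal R * δ := by
    calc _ ≤ _ := by gcongr
      _ ≤ _ := hle
      _ ≤ ENNReal.ofReal C := hμ
      _ ≤ ENNReal.ofReal (R * δ.toReal) := by
        refine ENNReal.ofReal_le_ofReal ?_
        have := (div_lt_iff₀ hδ').1 hR.1
        have := le_max_left C 0
        linarith
      _ = _ := by rw [ENNReal.ofReal_mul hR.2.le, ENNReal.ofReal_toReal hδt]
  exact (ENNReal.mul_le_mul_iff_right (by simpa using hR.2) ENNReal.ofReal_ne_top).1 h2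

/-- Integrate `gap_ge` against `μ ⊗ μ`, dropping the term in `y`. The constant comes from solving
`G/2 + b/2 ≤ k` for the integral `G` of the gap. -/
theorem lintegral_confinement_le (h : Confined V W m b κ) {k : ℝ} {μ : Prob d}
    (hμ : energy V W μ ≤ (k : EReal)) :
    ∫⁻ x, ENNReal.ofReal (V x - m) ∂(μ : Measure (Space d))
      ≤ ENNReal.ofReal (max (2 * k - b) 0 / κ) := by
  rw [h.energy_eq] at hμ
  have hκ := h.κ_pos
  set G := ∫⁻ p, gap V W b p ∂((μ : Measure (Space d)).prod (μ : Measure (Space d))) with hG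
  have hGt : G ≠ ⊤ := by
    rw [← lt_top_iff_ne_top, ← halfShift_lt_top_iff b]
    exact hμ.trans_lt (EReal.coe_lt_top _)
  have hGk : G ≤ ENNReal.ofReal (max (2 * k - b) 0) := by
    rw [← ENNReal.ofReal_toReal hGt] at hμ ⊢
    rw [halfShift_ofReal b ENNReal.toReal_nonneg] at hμ
    have : G.toReal / 2 + b / 2 ≤ k := by exact_mod_cast hμ
    refine ENNReal.ofReal_le_ofReal (le_max_of_le_left (by linarith))
  have h1 : ENNReal.ofReal κ * ∫⁻ x, ENNReal.ofReal (V x - m) ∂(μ : Measure (Space d)) ≤ G := by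
    have hm : Measurable fun x => ENNReal.ofReal (V x - m) :=
      (h.hV.continuous.measurable.sub_const _).ennreal_ofReal
    rw [← lintegral_const_mul _ hm, hG, lintegral_prod _ h.continuous_gap.measurable.aemeasurable]
    refine lintegral_mono fun x => ?_
    calc ENNReal.ofReal κ * ENNReal.ofReal (V x - m)
        = ∫⁻ _, ENNReal.ofReal κ * ENNReal.ofReal (V x - m) ∂(μ : Measure (Space d)) := by simp
      _ ≤ _ := by
        refine lintegral_mono fun y => ?_
        refine le_trans ?_ (h.gap_ge x y)
        rw [← ENNReal.ofReal_mul hκ.le]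
        refine ENNReal.ofReal_le_ofReal ?_
        have := h.lower y
        gcongr
        linarith
  rw [ENNReal.ofReal_div_of_pos hκ, ENNReal.le_div_iff_mul_le (by simp [hκ]) (by simp), mul_comm]
  exact h1.trans hGk

theorem isCompact_sublevel (h : Confined V W m b κ) (k : ℝ) :
    IsCompact {μ : Prob d | energy V W μ ≤ (k : EReal)} := by
  refine (h.isCompact_closure_confined (max (2 * k - b) 0 / κ)).of_isClosed_subset
    (h.lowerSemicontinuous_energy.isClosed_preimage (k : EReal)) ?_
  intro μ hμ
  exact subset_closure (h.lintegral_confinement_le hμ)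

theorem bot_lt_iInf_energy (h : Confined V W m b κ) : ⊥ < ⨅ μ : Prob d, energy V W μ :=
  (EReal.bot_lt_coe (b / 2)).trans_le (le_iInf h.le_energy)

/-- On a compact set where the energy exceeds `k`, so does one of its truncations. -/
theorem exists_truncGap_gt (h : Confined V W m b κ) {K : Set (Prob d)} (hK : IsCompact K)
    {k : EReal} (hk : ∀ μ ∈ K, k < energy V W μ) :
    ∃ n, ∀ μ ∈ K, k < halfShift b (truncGap V W b n μ) := by
  have hmono : Monotone fun n => {μ : Prob d | k < halfShift b (truncGap V W b n μ)} := by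
    intro i j hij μ hμ
    simp only [Set.mem_ofPred_eq] at hμ ⊢
    exact hμ.trans_le
      (monotone_halfShift b (monotone_truncGap μ hij))
  obtain ⟨n, hn⟩ := hK.elim_directed_cover
    (fun n => {μ : Prob d | k < halfShift b (truncGap V W b n μ)})
    (fun n => isOpen_lt continuous_const ((continuous_halfShift b).comp (h.continuous_truncGap n)))
    (fun μ hμ => Set.mem_iUnion.2
      ((h.tendsto_truncGap μ).eventually (lt_mem_nhds (hk μ hμ))).exists)
    hmono.directed_le
  exact ⟨n, fun μ hμ => hn hμ⟩

/-- The energy attains its infimum on every closed set where it is finite somewhere. -/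
theorem exists_isMin (h : Confined V W m b κ) {F : Set (Prob d)} (hF : IsClosed F)
    {μ₀ : Prob d} (hμ₀ : μ₀ ∈ F) (hfin : energy V W μ₀ < ⊤) :
    ∃ μ ∈ F, ∀ ν ∈ F, energy V W μ ≤ energy V W ν := by
  obtain ⟨k, hk, -⟩ := EReal.lt_iff_exists_real_btwn.1 hfin
  have hc : IsCompact ({μ : Prob d | energy V W μ ≤ (k : EReal)} ∩ F) :=
    (h.isCompact_sublevel k).inter_right hF
  obtain ⟨μ, hμ, hmin⟩ := (h.lowerSemicontinuous_energy.lowerSemicontinuousOn _).exists_isMinOn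
    (s := {μ : Prob d | energy V W μ ≤ (k : EReal)} ∩ F) ⟨μ₀, hk.le, hμ₀⟩ hc
  refine ⟨μ, hμ.2, fun ν hν => ?_⟩
  by_cases hνk : energy V W ν ≤ (k : EReal)
  · exact hmin ⟨hνk, hν⟩
  · exact (show energy V W μ ≤ k by simpa using hμ.1).trans (not_le.1 hνk).le

end Confined

/-! ### Empirical measures and lower bounds on the Hamiltonian -/

theorem coe_empirical {N : ℕ} (hN : N ≠ 0) (x : Fin N → Space d) :
    (empirical x : Measure (Space d)) = (N : ℝ≥0∞)⁻¹ • ∑ i, Measure.dirac (x i) := by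
  have h : empirical x
      = ⟨(N : ℝ≥0∞)⁻¹ • ∑ i, Measure.dirac (x i), isProbabilityMeasure_average hN x⟩ := dif_neg hN
  rw [h]
  rfl

theorem lintegral_empirical {N : ℕ} (hN : N ≠ 0) (x : Fin N → Space d) {f : Space d → ℝ≥0∞}
    (hf : Measurable f) :
    ∫⁻ y, f y ∂(empirical x : Measure (Space d)) = (N : ℝ≥0∞)⁻¹ * ∑ i, f (x i) := by
  rw [coe_empirical hN, lintegral_smul_measure, lintegral_finsetSum_measure]
  simp [lintegral_dirac' _ hf]

theorem integral_empirical {N : ℕ} (hN : N ≠ 0) (x : Fin N → Space d) {f : Space d → ℝ}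
    (hf : StronglyMeasurable f) :
    ∫ y, f y ∂(empirical x : Measure (Space d)) = (N : ℝ)⁻¹ * ∑ i, f (x i) := by
  have hi : ∀ i, Integrable f (Measure.dirac (x i)) := fun i =>
    integrable_dirac' hf (by simp)
  rw [coe_empirical hN, integral_smul_measure, integral_finsetSum_measure fun i _ => hi i]
  simp [integral_dirac' _ _ hf]

theorem sum_filter_lt_of_symm {N : ℕ} {f : Fin N × Fin N → ℝ≥0∞} (hf : ∀ p, f p = f p.swap) :
    ∑ p, f p = 2 * ∑ p ∈ (Finset.univ : Finset (Fin N × Fin N)).filter (fun p => p.1 < p.2), f p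
      + ∑ i, f (i, i) := by
  have h1 : ∑ p ∈ (Finset.univ : Finset (Fin N × Fin N)).filter (fun p => p.1 < p.2), f p
      = ∑ p ∈ (Finset.univ : Finset (Fin N × Fin N)).filter (fun p => p.2 < p.1), f p :=
    Finset.sum_bij' (fun p _ => p.swap) (fun p _ => p.swap) (by simp) (by simp) (by simp) (by simp)
      (fun p _ => hf p)
  have h3 : ∀ p : Fin N × Fin N, f p = (if p.1 < p.2 then f p else 0)
      + (if p.2 < p.1 then f p else 0) + (if p.1 = p.2 then f p else 0) := by
    intro p
    rcases lt_trichotomy p.1 p.2 with h | h | h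
    · simp [h, h.not_gt, h.ne]
    · simp [h]
    · simp [h, h.not_gt, h.ne']
  rw [two_mul]
  nth_rewrite 2 [h1]
  rw [Finset.sum_congr rfl fun p _ => h3 p, Finset.sum_add_distrib, Finset.sum_add_distrib,
    Finset.sum_filter, Finset.sum_filter]
  congr 1
  rw [Fintype.sum_prod_type]
  simp

namespace Confined

/-- The ordered off-diagonal pairs count each gap twice. On the diagonal the gap may be infinite,
but its truncation contributes at most `N` terms `n` of weight `1/N²`. -/
theorem truncGap_empirical_le (h : Confined V W m b κ) {N : ℕ} (hN : N ≠ 0) (n : ℕ)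
    (x : Fin N → Space d) :
    truncGap V W b n (empirical x)
      ≤ 2 * (ENNReal.ofReal (1 / (N : ℝ) ^ 2) * gapSum V W b x) + ENNReal.ofReal (n / N) := by
  have hN0 : (0 : ℝ) < N := by exact_mod_cast Nat.pos_of_ne_zero hN
  have hg : Measurable fun p => min (gap V W b p) n :=
    h.continuous_gap.measurable.min measurable_const
  have hinv : (N : ℝ≥0∞)⁻¹ = ENNReal.ofReal ((N : ℝ)⁻¹) := by
    rw [ENNReal.ofReal_inv_of_pos hN0, ENNReal.ofReal_natCast]
  have h1 : truncGap V W b n (empirical x)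
      = ENNReal.ofReal (1 / (N : ℝ) ^ 2) * ∑ p : Fin N × Fin N, min (gap V W b (x p.1, x p.2)) n := by
    rw [truncGap, lintegral_prod _ hg.aemeasurable,
      lintegral_empirical hN x (Measurable.lintegral_prod_right' hg), Fintype.sum_prod_type,
      Finset.sum_congr rfl fun i _ => lintegral_empirical hN x
        (f := fun y => min (gap V W b (x i, y)) n) (hg.comp measurable_prodMk_left), ← Finset.mul_sum, ← mul_assoc, hinv, ← ENNReal.ofReal_mul (by positivity)]
    congr 2
    field_simp
  rw [h1, sum_filter_lt_of_symm (fun p => by simp [h.gap_symm (x p.1) (x p.2)]), mul_add]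
  refine add_le_add ?_ ?_
  · rw [mul_left_comm]
    unfold gapSum
    gcongr
    exact min_le_left _ _
  · calc _ ≤ ENNReal.ofReal (1 / (N : ℝ) ^ 2) * ∑ i : Fin N, (n : ℝ≥0∞) := by
          gcongr
          exact min_le_right _ _
      _ = _ := by
        rw [Finset.sum_const, Finset.card_univ, Fintype.card_fin, nsmul_eq_mul,
          ← ENNReal.ofReal_natCast, ← ENNReal.ofReal_natCast, ← ENNReal.ofReal_mul (by positivity),
          ← ENNReal.ofReal_mul (by positivity)]
        congr 1
        field_simp

/-- The pair gaps yield `κ (N - 1)/N²` times `∑ (V(xᵢ) - m)`. The leftover `1/N²` from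
`hamiltonian_eq` completes this to `κ/N`, because `κ < 1`. -/
theorem le_hamiltonian (h : Confined V W m b κ) {N : ℕ} (hN : N ≠ 0) (x : Fin N → Space d) :
    ((κ * ((∑ i, (V (x i) - m)) / N) - (|b| + |m|) : ℝ) : EReal) ≤ hamiltonian V W N x := by
  have hN1 : (1 : ℝ) ≤ N := by exact_mod_cast Nat.one_le_iff_ne_zero.2 hN
  have hκ := h.κ_pos
  have hv : ∀ i, 0 ≤ V (x i) - m := fun i => by linarith [h.lower (x i)]
  have hS : 0 ≤ ∑ i, (V (x i) - m) := Finset.sum_nonneg fun i _ => hv i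
  have hSV : ∑ i, V (x i) = ∑ i, (V (x i) - m) + N * m := by simp
  set S := ∑ i, (V (x i) - m) with hSdef
  have h1 : ENNReal.ofReal (κ * ((N - 1) * S)) ≤ gapSum V W b x := by
    rw [hSdef, ← sum_filter_lt_add (fun i => V (x i) - m), Finset.mul_sum,
      ENNReal.ofReal_sum_of_nonneg]
    · exact Finset.sum_le_sum fun p _ => h.gap_ge _ _
    · intro p _
      have := hv p.1; have := hv p.2
      positivity
  have h2 : ((1 / (N : ℝ) ^ 2 * (κ * ((N - 1) * S)) : ℝ) : EReal)
      ≤ ((ENNReal.ofReal (1 / (N : ℝ) ^ 2) * gapSum V W b x : ℝ≥0∞) : EReal) := by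
    have hp : 0 ≤ 1 / (N : ℝ) ^ 2 * (κ * ((N - 1) * S)) := by
      have : (0 : ℝ) ≤ N - 1 := by linarith
      positivity
    calc _ = ((ENNReal.ofReal (1 / (N : ℝ) ^ 2 * (κ * ((N - 1) * S))) : ℝ≥0∞) : EReal) := by
          rw [EReal.coe_ennreal_ofReal, max_eq_left hp]
      _ ≤ _ := by
        rw [EReal.coe_ennreal_le_coe_ennreal_iff, ENNReal.ofReal_mul (by positivity)]
        gcongr
  rw [h.hamiltonian_eq hN]
  refine le_trans ?_ (add_le_add_left h2 _)
  rw [← EReal.coe_add, EReal.coe_le_coe_iff, hSV]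
  have e1 : 1 / (N : ℝ) ^ 2 * (κ * ((N - 1) * S)) + (b * (N - 1) / (2 * N) + (S + N * m) / N ^ 2)
      - (κ * (S / N) - (|b| + |m|))
      = (1 - κ) * S / N ^ 2 + (|b| + b * ((N - 1) / (2 * N))) + (|m| + m * (1 / N)) := by
    field_simp
    ring
  have e2 : 0 ≤ (1 - κ) * S / N ^ 2 := by
    have := h.κ_lt
    have : 0 ≤ 1 - κ := by linarith
    positivity
  have e3 : ∀ a t : ℝ, 0 ≤ t → t ≤ 1 → 0 ≤ |a| + a * t := by
    intro a t h0 h1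
    have : |a * t| ≤ |a| := by
      rw [abs_mul, abs_of_nonneg h0]
      exact mul_le_of_le_one_right (abs_nonneg _) h1
    linarith [neg_abs_le (a * t)]
  have e4 := e3 b ((N - 1) / (2 * N)) (div_nonneg (by linarith) (by linarith))
    ((div_le_one (by linarith)).2 (by linarith))
  have e5 := e3 m (1 / N) (by positivity) ((div_le_one (by linarith)).2 hN1)
  linarith

/-- The deterministic core of the upper bound: a configuration with `H_N < k` has its empirical
measure in a fixed compact set, where one truncation level works for all measures at once. -/
theorem eventually_le_hamiltonian (h : Confined V W m b κ) {A : Set (Prob d)} {k : ℝ}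
    (hk : (k : EReal) < ⨅ μ ∈ closure A, energy V W μ) :
    ∀ᶠ N : ℕ in atTop, ∀ x : Fin N → Space d, empirical x ∈ A →
      (k : EReal) ≤ hamiltonian V W N x := by
  obtain ⟨k', hkk', hk'⟩ := EReal.lt_iff_exists_real_btwn.1 hk
  have hkk' : k < k' := by exact_mod_cast hkk'
  have hκ := h.κ_pos
  -- By `le_hamiltonian`, `H_N < k` forces the mean of `V - m` below this value.
  set C := (k + (|b| + |m|)) / κ with hC
  set K := closure {μ : Prob d |
      ∫⁻ x, ENNReal.ofReal (V x - m) ∂(μ : Measure (Space d)) ≤ ENNReal.ofReal C} with hKdef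
  have hK : IsCompact (K ∩ closure A) := (h.isCompact_closure_confined C).inter_right isClosed_closure
  obtain ⟨n, hn⟩ := h.exists_truncGap_gt hK (k := k') (fun μ hμ =>
    hk'.trans_le (iInf₂_le μ hμ.2))
  have hlim : Tendsto (fun N : ℕ => ((n : ℝ) / 2 + |b| + |m|) / N) atTop (𝓝 0) :=
    tendsto_const_div_atTop_nhds_zero_nat _
  -- The margin `k' - k` absorbs the halved diagonal term `n/(2N)` and the `1/N` corrections in `b`
  -- and `m`.
  filter_upwards [hlim.eventually (gt_mem_nhds (show (0 : ℝ) < k' - k by linarith)),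
    eventually_ne_atTop 0] with N hN hN0 x hx
  by_contra hcon
  rw [not_le] at hcon
  have hN1 : (1 : ℝ) ≤ N := by exact_mod_cast Nat.one_le_iff_ne_zero.2 hN0
  have hv : ∀ i, 0 ≤ V (x i) - m := fun i => by linarith [h.lower (x i)]
  have hmem : empirical x ∈ K ∩ closure A := by
    refine ⟨subset_closure ?_, subset_closure hx⟩
    have h1 := (h.le_hamiltonian hN0 x).trans_lt hcon
    rw [EReal.coe_lt_coe_iff] at h1
    have hm : Measurable fun x => ENNReal.ofReal (V x - m) :=
      (h.hV.continuous.measurable.sub_const _).ennreal_ofReal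
    rw [Set.mem_ofPred_eq, lintegral_empirical hN0 x hm,
      ← ENNReal.ofReal_sum_of_nonneg fun i _ => hv i, ← ENNReal.ofReal_natCast,
      ← ENNReal.ofReal_inv_of_pos (by linarith), ← ENNReal.ofReal_mul (by positivity)]
    refine ENNReal.ofReal_le_ofReal ?_
    rw [hC, le_div_iff₀ hκ, ← div_eq_inv_mul]
    linarith
  have h2 := (hn _ hmem).trans_le (monotone_halfShift b (h.truncGap_empirical_le hN0 n x))
  rw [h.hamiltonian_eq hN0] at hcon
  set G := ENNReal.ofReal (1 / (N : ℝ) ^ 2) * gapSum V W b x with hG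
  have hGt : G ≠ ⊤ := by
    intro hGt
    rw [hGt, EReal.coe_ennreal_top, EReal.top_add_coe] at hcon
    exact not_top_lt hcon
  have hG2 : G = ENNReal.ofReal G.toReal := (ENNReal.ofReal_toReal hGt).symm
  have hG0 : 0 ≤ G.toReal := ENNReal.toReal_nonneg
  have hn0 : (0 : ℝ) ≤ n / N := by positivity
  rw [hG2] at h2 hcon
  rw [EReal.coe_ennreal_ofReal, max_eq_left hG0, ← EReal.coe_add, EReal.coe_lt_coe_iff] at hcon
  rw [← ENNReal.ofReal_ofNat, ← ENNReal.ofReal_mul (by norm_num),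
    ← ENNReal.ofReal_add (by positivity) hn0, halfShift_ofReal b (by positivity),
    EReal.coe_lt_coe_iff] at h2
  have hSV : (N : ℝ) * m ≤ ∑ i, V (x i) := by
    have := Finset.sum_nonneg fun i (_ : i ∈ Finset.univ) => hv i
    simp at this
    linarith
  have e1 : -|m| / N ≤ (∑ i, V (x i)) / (N : ℝ) ^ 2 := by
    rw [div_le_div_iff₀ (by linarith) (by positivity)]
    have := neg_abs_le m
    have : (N : ℝ) * -|m| ≤ ∑ i, V (x i) := le_trans (by gcongr) hSV
    nlinarith
  have e2 : b / 2 - |b| / N ≤ b * (N - 1) / (2 * N) := by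
    have : b * (N - 1) / (2 * N) = b / 2 - b / (2 * N) := by field_simp
    rw [this]
    have : b / (2 * N) ≤ |b| / N := by
      rw [div_le_div_iff₀ (by linarith) (by linarith)]
      nlinarith [le_abs_self b, abs_nonneg b, mul_nonneg (abs_nonneg b) (by linarith : (0:ℝ) ≤ N)]
    linarith
  have e3 : ((n : ℝ) / 2 + |b| + |m|) / N = n / N / 2 + |b| / N + |m| / N := by ring
  have e4 : -|m| / N = -(|m| / N) := by ring
  linarith

/-! ### Upper bound for the Gibbs mass -/

/-- Split `β H = (β - N/κ) H + (N/κ) H`. The second part dominates `∑ V(xᵢ)` up to `O(N)` by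
`le_hamiltonian`, which produces the integrable product; the first keeps the level `k`. -/
theorem weight_le (h : Confined V W m b κ) {N : ℕ} (hN : N ≠ 0) {x : Fin N → Space d} {β k : ℝ}
    (hk : (k : EReal) ≤ hamiltonian V W N x) (hβ : N / κ ≤ β) :
    weight V W β N x ≤ ENNReal.ofReal
      (Real.exp (-(β - N / κ) * k + N * ((|b| + |m|) / κ + m)) * ∏ i, Real.exp (-V (x i))) := by
  have hN1 : (1 : ℝ) ≤ N := by exact_mod_cast Nat.one_le_iff_ne_zero.2 hN
  have hκ := h.κ_pos
  have hb := h.le_hamiltonian hN x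
  have hβ0 : 0 < β := lt_of_lt_of_le (by positivity) hβ
  rw [weight]
  induction hH : hamiltonian V W N x with
  | bot => rw [hH] at hk; simp at hk
  | top => rw [EReal.coe_mul_top_of_pos hβ0]; simp
  | coe H =>
    rw [hH] at hk hb
    rw [EReal.coe_le_coe_iff] at hk hb
    rw [← EReal.coe_mul, ← EReal.coe_neg, EReal.exp_coe, ← Real.exp_sum, ← Real.exp_add]
    refine ENNReal.ofReal_le_ofReal (Real.exp_le_exp.2 ?_)
    rw [Finset.sum_neg_distrib]
    have hSV : ∑ i, V (x i) = ∑ i, (V (x i) - m) + N * m := by simp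
    have h1 : ∑ i, (V (x i) - m) ≤ N / κ * (H + (|b| + |m|)) := by
      have h2 : κ * (∑ i, (V (x i) - m)) / N ≤ H + (|b| + |m|) := by
        rw [mul_div_assoc]; linarith
      rw [div_le_iff₀ (by linarith)] at h2
      rw [div_mul_eq_mul_div, le_div_iff₀ hκ]
      linarith
    have h3 : (β - N / κ) * k ≤ (β - N / κ) * H :=
      mul_le_mul_of_nonneg_left hk (by linarith)
    have h4 : (N : ℝ) * ((|b| + |m|) / κ + m) = N / κ * (|b| + |m|) + N * m := by ring
    rw [hSV, h4]
    linarith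

/-- The unnormalized Gibbs mass of `{μ_N ∈ A}` is at most exponential in `-β k` if the energy of
the configurations in `A` is at least `k`. -/
theorem lintegral_weight_le (h : Confined V W m b κ) {N : ℕ} (hN : N ≠ 0) {A : Set (Prob d)}
    {β k : ℝ} (hk : ∀ x : Fin N → Space d, empirical x ∈ A → (k : EReal) ≤ hamiltonian V W N x)
    (hA : MeasurableSet {x : Fin N → Space d | empirical x ∈ A}) (hβ : N / κ ≤ β) :
    ∫⁻ x in {x : Fin N → Space d | empirical x ∈ A}, weight V W β N x ≤ ENNReal.ofReal
      (Real.exp (-(β - N / κ) * k + N * ((|b| + |m|) / κ + m + Real.log (∫ x, Real.exp (-V x))))) := by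
  have hpos : 0 < ∫ x, Real.exp (-V x) := by
    exact integral_exp_pos h.hV.integrable
  have hint : Integrable (fun x : Fin N → Space d => ∏ i, Real.exp (-V (x i))) := by
    rw [volume_pi]
    exact Integrable.fintype_prod fun _ => h.hV.integrable
  calc ∫⁻ x in {x : Fin N → Space d | empirical x ∈ A}, weight V W β N x
      ≤ ∫⁻ x in {x : Fin N → Space d | empirical x ∈ A}, ENNReal.ofReal
        (Real.exp (-(β - N / κ) * k + N * ((|b| + |m|) / κ + m)) * ∏ i, Real.exp (-V (x i))) :=
        setLIntegral_mono' hA fun x hx => h.weight_le hN (hk x hx) hβ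
    _ ≤ ∫⁻ x : Fin N → Space d, ENNReal.ofReal
        (Real.exp (-(β - N / κ) * k + N * ((|b| + |m|) / κ + m)) * ∏ i, Real.exp (-V (x i))) :=
        setLIntegral_le_lintegral _ _
    _ = ENNReal.ofReal (∫ x : Fin N → Space d,
        Real.exp (-(β - N / κ) * k + N * ((|b| + |m|) / κ + m)) * ∏ i, Real.exp (-V (x i))) := by
        rw [ofReal_integral_eq_lintegral_ofReal (hint.const_mul _)]
        exact Eventually.of_forall fun x => by positivity
    _ = _ := by
        rw [integral_const_mul, integral_fintype_prod_volume_eq_pow (fun x => Real.exp (-V x)),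
          Fintype.card_fin]
        nth_rewrite 1 [← Real.exp_log hpos]
        rw [← Real.exp_nat_mul, ← Real.exp_add]
        congr 2
        ring

end Confined

theorem measurable_empirical {N : ℕ} {A : Set (Prob d)} (hA : MeasurableSet[borel (Prob d)] A) :
    MeasurableSet {x : Fin N → Space d | empirical x ∈ A} := by
  by_cases hN : N = 0
  · subst hN
    exact Subsingleton.measurableSet
  have hc : Continuous (empirical : (Fin N → Space d) → Prob d) := by
    rw [ProbabilityMeasure.continuous_iff_forall_continuous_integral]
    intro f
    simp_rw [integral_empirical hN _ f.continuous.stronglyMeasurable]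
    fun_prop
  have := hc.borel_measurable
  rw [← BorelSpace.measurable_eq] at this
  exact this hA

theorem log_div_le {Q : ℝ≥0∞} {β u : ℝ} (hβ : 0 < β) (hQ : Q ≤ ENNReal.ofReal (Real.exp u)) :
    ENNReal.log Q / (β : EReal) ≤ ((u / β : ℝ) : EReal) := by
  have h1 := ENNReal.log_monotone hQ
  rw [← EReal.exp_coe, EReal.log_exp] at h1
  rw [EReal.coe_div]
  exact EReal.div_le_div_right_of_nonneg (by exact_mod_cast hβ.le) h1

theorem le_log_div {Q : ℝ≥0∞} {β u : ℝ} (hβ : 0 < β) (hQ : ENNReal.ofReal (Real.exp u) ≤ Q) :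
    ((u / β : ℝ) : EReal) ≤ ENNReal.log Q / (β : EReal) := by
  have h1 := ENNReal.log_monotone hQ
  rw [← EReal.exp_coe, EReal.log_exp] at h1
  rw [EReal.coe_div]
  exact EReal.div_le_div_right_of_nonneg (by exact_mod_cast hβ.le) h1

namespace Confined

theorem limsup_lintegral_weight_le (h : Confined V W m b κ) {β : ℕ → ℝ} (hpos : ∀ N, 0 < β N)
    (hβ : Tendsto (fun N : ℕ => (N : ℝ) / β N) atTop (𝓝 0)) {A : Set (Prob d)}
    (hA : MeasurableSet[borel (Prob d)] A) :
    limsup (fun N : ℕ => ENNReal.log (∫⁻ x in {x : Fin N → Space d | empirical x ∈ A},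
        weight V W (β N) N x) / (β N : EReal)) atTop
      ≤ -(⨅ μ ∈ closure A, energy V W μ) := by
  rw [EReal.le_neg]
  -- It is enough to treat every real `k` strictly below the infimum.
  refine EReal.ge_of_forall_gt_iff_ge.1 fun k hk => ?_
  rw [EReal.le_neg]
  set a : ℝ := (|b| + |m|) / κ + m + Real.log (∫ x, Real.exp (-V x)) with ha
  have hlim : Tendsto (fun N : ℕ => ((-k + (N / β N) * (k / κ + a) : ℝ) : EReal)) atTop
      (𝓝 (-(k : EReal))) := by
    rw [← EReal.coe_neg, EReal.tendsto_coe]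
    simpa using (hβ.mul_const (k / κ + a)).const_add (-k)
  rw [← hlim.limsup_eq]
  refine limsup_le_limsup ?_
  filter_upwards [h.eventually_le_hamiltonian hk, eventually_ne_atTop 0,
    hβ.eventually (gt_mem_nhds h.κ_pos)] with N hN hN0 hNβ
  have h1 : N / κ ≤ β N := by
    rw [div_lt_iff₀ (hpos N)] at hNβ
    rw [div_le_iff₀ h.κ_pos]
    linarith
  refine (log_div_le (hpos N) (h.lintegral_weight_le hN0 hN (measurable_empirical hA) h1)).trans
    (le_of_eq ?_)
  congr 1
  have := (hpos N).ne'
  have := h.κ_pos.ne'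
  rw [← ha]
  field_simp
  ring

theorem partitionFn_lt_top (h : Confined V W m b κ) {N : ℕ} (hN : N ≠ 0) {β : ℝ}
    (hβ : N / κ ≤ β) : partitionFn V W β N < ⊤ := by
  -- This level bounds `H_N` from below on all configurations.
  have h1 := h.lintegral_weight_le hN (A := Set.univ) (k := -(|b| + |m|)) (β := β)
    (fun x _ => by
      refine le_trans ?_ (h.le_hamiltonian hN x)
      rw [EReal.coe_le_coe_iff]
      have : 0 ≤ ∑ i, (V (x i) - m) :=
        Finset.sum_nonneg fun i _ => by linarith [h.lower (x i)]
      have := h.κ_pos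
      have : 0 ≤ κ * ((∑ i, (V (x i) - m)) / N) := by positivity
      linarith) (by simp) hβ
  simp only [Set.mem_univ, Set.ofPred_true, Measure.restrict_univ] at h1
  exact h1.trans_lt ENNReal.ofReal_lt_top

end Confined

/-! ### Lower bound for the Gibbs mass by i.i.d. sampling -/

/-- The sets of probability measures to which the empirical measure of an i.i.d. sample of `μ`
belongs with probability tending to one. -/
noncomputable def sampleFilter (μ : Prob d) : Filter (Prob d) where
  sets := {S | Tendsto (fun N : ℕ => Measure.pi (fun _ : Fin N => (μ : Measure (Space d)))
    {x | empirical x ∉ S}) atTop (𝓝 0)}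
  univ_sets := by simp
  sets_of_superset := by
    intro S T hS hST
    exact tendsto_of_tendsto_of_tendsto_of_le_of_le tendsto_const_nhds hS (fun _ => zero_le)
      fun N => measure_mono fun x hx hxS => hx (hST hxS)
  inter_sets := by
    intro S T hS hT
    have := Tendsto.add hS hT
    rw [add_zero] at this
    refine tendsto_of_tendsto_of_tendsto_of_le_of_le tendsto_const_nhds this (fun _ => zero_le)
      fun N => le_trans (measure_mono ?_) (measure_union_le _ _)
    intro x hx
    by_cases hxS : empirical x ∈ S
    · exact Or.inr fun hxT => hx ⟨hxS, hxT⟩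
    · exact Or.inl hxS

/-- The weak law of large numbers for empirical measures. -/
theorem sampleFilter_le_nhds (μ : Prob d) : sampleFilter μ ≤ 𝓝 μ := by
  -- Weak convergence along a filter is tested on one bounded continuous function at a time, so
  -- Chebyshev's inequality for a single `f` suffices; the filter axioms take care of finite
  -- intersections.
  rw [← tendsto_id', ProbabilityMeasure.tendsto_iff_forall_integral_tendsto]
  intro f
  rw [Metric.tendsto_nhds]
  intro ε hε
  have hmem : MemLp f 2 (μ : Measure (Space d)) :=
    (memLp_top_of_bound f.continuous.aestronglyMeasurable ‖f‖
      (Eventually.of_forall f.norm_coe_le_norm)).mono_exponent le_top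
  set v := ProbabilityTheory.variance f (μ : Measure (Space d)) with hv
  have hlim : Tendsto (fun N : ℕ => ENNReal.ofReal (v / ε ^ 2 / N)) atTop (𝓝 0) := by
    rw [← ENNReal.ofReal_zero]
    exact (ENNReal.continuous_ofReal.tendsto 0).comp (tendsto_const_div_atTop_nhds_zero_nat _)
  refine tendsto_of_tendsto_of_tendsto_of_le_of_le' tendsto_const_nhds hlim
    (Eventually.of_forall fun _ => zero_le) ?_
  filter_upwards [eventually_ne_atTop 0] with N hN
  have hN' : (N : ℝ) ≠ 0 := by exact_mod_cast hN
  set P := Measure.pi (fun _ : Fin N => (μ : Measure (Space d))) with hP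
  set X : (Fin N → Space d) → ℝ := fun x => (N : ℝ)⁻¹ * (∑ i, fun x : Fin N → Space d => f (x i)) x
    with hX
  have hXi : ∀ i : Fin N, MemLp (fun x : Fin N → Space d => f (x i)) 2 P := fun i =>
    hmem.comp_measurePreserving (measurePreserving_eval (fun _ => (μ : Measure (Space d))) i)
  have hX2 : MemLp X 2 P := (memLp_finsetSum' _ fun i _ => hXi i).const_mul _
  have hvar : ProbabilityTheory.variance X P = v / N := by
    rw [hX, ProbabilityTheory.variance_const_mul,
      ProbabilityTheory.variance_sum_pi (X := fun _ => f) fun _ => hmem]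
    simp only [Finset.sum_const, Finset.card_univ, Fintype.card_fin, nsmul_eq_mul, ← hv]
    field_simp
  have hmean : ∫ x, X x ∂P = ∫ y, f y ∂(μ : Measure (Space d)) := by
    rw [hX, integral_const_mul]
    simp only [Finset.sum_apply]
    rw [integral_finsetSum _ fun i _ => (hXi i).integrable (by norm_num)]
    simp_rw [hP, integral_comp_eval (X := fun _ : Fin N => Space d)
      (μ := fun _ => (μ : Measure (Space d))) (f := f) f.continuous.aestronglyMeasurable]
    simp only [Finset.sum_const, Finset.card_univ, Fintype.card_fin, nsmul_eq_mul]
    field_simp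
  have hcheb := ProbabilityTheory.meas_ge_le_variance_div_sq hX2 hε
  rw [hvar, hmean] at hcheb
  have e : v / ε ^ 2 / N = v / N / ε ^ 2 := by ring
  rw [e]
  refine le_trans (measure_mono fun x hx => ?_) hcheb
  simp only [Set.mem_ofPred_eq, not_lt, id_eq, Real.dist_eq] at hx ⊢
  rw [integral_empirical hN x f.continuous.stronglyMeasurable] at hx
  simpa [hX] using hx

theorem tendsto_pi_empirical_notMem {μ : Prob d} {A : Set (Prob d)} (hA : A ∈ 𝓝 μ) :
    Tendsto (fun N : ℕ => Measure.pi (fun _ : Fin N => (μ : Measure (Space d)))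
      {x | empirical x ∉ A}) atTop (𝓝 0) :=
  sampleFilter_le_nhds μ hA

/-- The bound is clear on boxes, and the product outer measure is the largest one with prescribed
bounds on boxes. This replaces any entropy estimate in the lower bound. -/
theorem pi_le_smul_volume {μ : Prob d} {B : NNReal}
    (hB : (μ : Measure (Space d)) ≤ B • volume) (N : ℕ) :
    Measure.pi (fun _ : Fin N => (μ : Measure (Space d)))
      ≤ (B ^ N : NNReal) • (volume : Measure (Fin N → Space d)) := by
  have h1 : Measure.pi (fun _ : Fin N => B • (volume : Measure (Space d)))
      = (B ^ N : NNReal) • (volume : Measure (Fin N → Space d)) := by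
    refine Measure.pi_eq fun s _ => ?_
    rw [volume_pi, Measure.smul_apply, Measure.pi_pi]
    simp only [Measure.smul_apply, ENNReal.smul_def, smul_eq_mul, Finset.prod_mul_distrib]
    simp
  rw [← h1]
  have h2 : (Measure.pi (fun _ : Fin N => (μ : Measure (Space d)))).toOuterMeasure
      ≤ OuterMeasure.pi fun _ : Fin N => (B • (volume : Measure (Space d))).toOuterMeasure := by
    rw [OuterMeasure.le_pi]
    intro s _
    refine (Measure.pi_pi _ s).le.trans ?_
    exact Finset.prod_le_prod' fun i _ => hB (s i)
  rw [Measure.le_iff]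
  intro s hs
  rw [Measure.pi_def fun _ : Fin N => B • (volume : Measure (Space d)), toMeasure_apply _ _ hs]
  exact h2 s

theorem lintegral_pi_pair (μ : Prob d) {N : ℕ} {i j : Fin N} (hij : i ≠ j)
    {g : Space d × Space d → ℝ≥0∞} (hg : Measurable g) :
    ∫⁻ x, g (x i, x j) ∂Measure.pi (fun _ : Fin N => (μ : Measure (Space d)))
      = ∫⁻ p, g p ∂((μ : Measure (Space d)).prod (μ : Measure (Space d))) := by
  have hind := (ProbabilityTheory.iIndepFun_pi (μ := fun _ : Fin N => (μ : Measure (Space d)))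
    (X := fun _ => id) fun _ => aemeasurable_id).indepFun hij
  change ProbabilityTheory.IndepFun (Function.eval i) (Function.eval j) _ at hind
  have hi := measurePreserving_eval (fun _ : Fin N => (μ : Measure (Space d))) i
  have hj := measurePreserving_eval (fun _ : Fin N => (μ : Measure (Space d))) j
  rw [ProbabilityTheory.indepFun_iff_map_prod_eq_prod_map_map hi.measurable.aemeasurable
    hj.measurable.aemeasurable] at hind
  have hmap : Measure.map (fun x : Fin N → Space d => (x i, x j))
      (Measure.pi (fun _ : Fin N => (μ : Measure (Space d))))
      = (μ : Measure (Space d)).prod (μ : Measure (Space d)) := by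
    refine hind.trans ?_
    congr 1
    · exact hi.map_eq
    · exact hj.map_eq
  rw [← hmap, lintegral_map hg ((measurable_pi_apply i).prodMk (measurable_pi_apply j))]

namespace Confined

theorem measurable_gapSum (h : Confined V W m b κ) {N : ℕ} :
    Measurable fun x : Fin N → Space d => gapSum V W b x :=
  Finset.measurable_fun_sum _ fun p _ => h.continuous_gap.measurable.comp
    ((measurable_pi_apply p.1).prodMk (measurable_pi_apply p.2))

theorem lintegral_gapSum (h : Confined V W m b κ) (μ : Prob d) (N : ℕ) :
    ∫⁻ x, gapSum V W b x ∂Measure.pi (fun _ : Fin N => (μ : Measure (Space d)))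
      = (((Finset.univ : Finset (Fin N × Fin N)).filter (fun p => p.1 < p.2)).card : ℝ≥0∞)
        * ∫⁻ p, gap V W b p ∂((μ : Measure (Space d)).prod (μ : Measure (Space d))) := by
  unfold gapSum
  have hm : ∀ p : Fin N × Fin N, Measurable fun x : Fin N → Space d => gap V W b (x p.1, x p.2) :=
    fun p => h.continuous_gap.measurable.comp
      ((measurable_pi_apply p.1).prodMk (measurable_pi_apply p.2))
  rw [lintegral_finsetSum _ fun p _ => hm p, Finset.sum_congr rfl fun p hp =>
    lintegral_pi_pair μ (Finset.mem_filter.1 hp).2.ne h.continuous_gap.measurable]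
  simp

theorem measurable_hamiltonian (h : Confined V W m b κ) {N : ℕ} (hN : N ≠ 0) :
    Measurable fun x : Fin N → Space d => hamiltonian V W N x := by
  simp_rw [h.hamiltonian_eq hN]
  refine Measurable.add ?_ ?_
  · exact measurable_coe_ennreal_ereal.comp (h.measurable_gapSum.const_mul _)
  · refine measurable_coe_real_ereal.comp ?_
    have hV := h.hV.continuous.measurable
    exact ((Finset.measurable_fun_sum _ fun i _ => hV.comp (measurable_pi_apply i)).div_const
      _).const_add _

/-- With positive probability, an i.i.d. sample of `μ` has energy at most `k > I(μ)`. -/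
theorem eventually_pi_lt (h : Confined V W m b κ) {μ : Prob d} {R k : ℝ}
    (hR : ∀ᵐ x ∂(μ : Measure (Space d)), V x ≤ R) (hk : energy V W μ < (k : EReal)) :
    ∃ q : ℝ≥0∞, q < 1 ∧ ∀ᶠ N : ℕ in atTop, Measure.pi (fun _ : Fin N => (μ : Measure (Space d)))
      {x | ¬ hamiltonian V W N x ≤ (k : EReal)} ≤ q := by
  rw [h.energy_eq] at hk
  set G := ∫⁻ p, gap V W b p ∂((μ : Measure (Space d)).prod (μ : Measure (Space d))) with hG
  have hGt : G ≠ ⊤ := by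
    rw [← lt_top_iff_ne_top, ← halfShift_lt_top_iff b]
    exact hk.trans (EReal.coe_lt_top _)
  have hG2 : G = ENNReal.ofReal G.toReal := (ENNReal.ofReal_toReal hGt).symm
  have hG0 : 0 ≤ G.toReal := ENNReal.toReal_nonneg
  rw [hG2, halfShift_ofReal b hG0, EReal.coe_lt_coe_iff] at hk
  -- The normalized sum of gaps has mean at most `G/2`, so Markov at level `k₁` gives a failure
  -- probability at most `(G/2)/k₁ < 1`. The room between `k₁` and `k - b/2` absorbs the terms in
  -- `|b|/N` and `|R|/N`.
  obtain ⟨k₁, hk₁, hk₁'⟩ := exists_between (show G.toReal / 2 < k - b / 2 by linarith)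
  have hk₁0 : 0 < k₁ := by linarith
  refine ⟨ENNReal.ofReal (G.toReal / 2 / k₁), ?_, ?_⟩
  · rw [← ENNReal.ofReal_one, ENNReal.ofReal_lt_ofReal_iff one_pos, div_lt_one hk₁0]
    exact hk₁
  have hlim : Tendsto (fun N : ℕ => (|b| + |R|) / (N : ℝ)) atTop (𝓝 0) :=
    tendsto_const_div_atTop_nhds_zero_nat _
  filter_upwards [hlim.eventually (gt_mem_nhds (show (0 : ℝ) < k - b / 2 - k₁ by linarith)),
    eventually_ne_atTop 0] with N hN hN0
  have hN1 : (1 : ℝ) ≤ N := by exact_mod_cast Nat.one_le_iff_ne_zero.2 hN0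
  set P := Measure.pi (fun _ : Fin N => (μ : Measure (Space d))) with hP
  have hRN : ∀ᵐ x ∂P, ∀ i, V (x i) ≤ R :=
    ae_all_iff.2 fun i => (measurePreserving_eval (fun _ : Fin N => (μ : Measure (Space d)))
      i).quasiMeasurePreserving.ae hR
  have hsub : {x | ¬ hamiltonian V W N x ≤ (k : EReal)} ≤ᵐ[P]
      {x | ENNReal.ofReal k₁ ≤ ENNReal.ofReal (1 / (N : ℝ) ^ 2) * gapSum V W b x} := by
    filter_upwards [hRN] with x hx hxk
    change ENNReal.ofReal k₁ ≤ ENNReal.ofReal (1 / (N : ℝ) ^ 2) * gapSum V W b x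
    change ¬ hamiltonian V W N x ≤ (k : EReal) at hxk
    by_contra hlt
    rw [not_le] at hlt
    apply hxk
    rw [h.hamiltonian_eq hN0]
    have h1 : ((ENNReal.ofReal (1 / (N : ℝ) ^ 2) * gapSum V W b x : ℝ≥0∞) : EReal) ≤ (k₁ : EReal) := by
      calc _ ≤ ((ENNReal.ofReal k₁ : ℝ≥0∞) : EReal) :=
            EReal.coe_ennreal_le_coe_ennreal_iff.2 hlt.le
        _ = _ := by rw [EReal.coe_ennreal_ofReal, max_eq_left hk₁0.le]
    refine (add_le_add_left h1 _).trans ?_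
    rw [← EReal.coe_add, EReal.coe_le_coe_iff]
    have hsum : ∑ i, V (x i) ≤ N * |R| := by
      calc ∑ i, V (x i) ≤ ∑ _i : Fin N, |R| :=
            Finset.sum_le_sum fun i _ => (hx i).trans (le_abs_self R)
        _ = _ := by simp
    have e1 : (∑ i, V (x i)) / (N : ℝ) ^ 2 ≤ |R| / N := by
      rw [div_le_div_iff₀ (by positivity) (by linarith)]
      nlinarith
    have e2 : b * (N - 1) / (2 * N) ≤ b / 2 + |b| / N := by
      have : b * (N - 1) / (2 * N) = b / 2 + (-b) / (2 * N) := by field_simp; ring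
      rw [this]
      have : (-b) / (2 * N) ≤ |b| / N := by
        rw [div_le_div_iff₀ (by linarith) (by linarith)]
        nlinarith [neg_abs_le b, abs_nonneg b, mul_nonneg (abs_nonneg b) (by linarith : (0:ℝ) ≤ N)]
      linarith
    have e3 : (|b| + |R|) / (N : ℝ) = |b| / N + |R| / N := by ring
    linarith
  have hmarkov := mul_meas_ge_le_lintegral (μ := P)
    (h.measurable_gapSum.const_mul (ENNReal.ofReal (1 / (N : ℝ) ^ 2))) (ENNReal.ofReal k₁)
  rw [lintegral_const_mul _ h.measurable_gapSum, hP, h.lintegral_gapSum, ← hG, ← hP] at hmarkov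
  have hcard : (((Finset.univ : Finset (Fin N × Fin N)).filter (fun p => p.1 < p.2)).card : ℝ)
      = (N - 1) * N / 2 := by
    have := two_mul_card_filter_lt N
    linarith
  have hle : ENNReal.ofReal (1 / (N : ℝ) ^ 2) *
      ((((Finset.univ : Finset (Fin N × Fin N)).filter (fun p => p.1 < p.2)).card : ℝ≥0∞) * G)
      ≤ ENNReal.ofReal (G.toReal / 2) := by
    rw [← ENNReal.ofReal_natCast, hcard, hG2, ENNReal.toReal_ofReal hG0, ← ENNReal.ofReal_mul,
      ← ENNReal.ofReal_mul (by positivity)]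
    · refine ENNReal.ofReal_le_ofReal ?_
      have : 1 / (N : ℝ) ^ 2 * ((N - 1) * N / 2 * G.toReal) = G.toReal / 2 * ((N - 1) / N) := by
        field_simp
      rw [this]
      refine mul_le_of_le_one_right (by positivity) ?_
      rw [div_le_one (by linarith)]
      linarith
    · have : (0 : ℝ) ≤ N - 1 := by linarith
      positivity
  rw [ENNReal.ofReal_div_of_pos hk₁0, ENNReal.le_div_iff_mul_le (by simp [hk₁0]) (by simp), mul_comm]
  refine le_trans ?_ (hmarkov.trans hle)
  exact mul_le_mul_right (measure_mono_ae hsub) _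

/-- The lower bound of the unnormalized Gibbs mass for a measure with bounded density on which `V`
is bounded. -/
theorem exists_le_lintegral_weight (h : Confined V W m b κ) {μ : Prob d} {R k : ℝ} {B : NNReal}
    (hB0 : B ≠ 0) (hB : (μ : Measure (Space d)) ≤ B • volume)
    (hR : ∀ᵐ x ∂(μ : Measure (Space d)), V x ≤ R) (hk : energy V W μ < (k : EReal))
    {β : ℕ → ℝ} (hpos : ∀ N, 0 < β N) {A : Set (Prob d)} (hAμ : A ∈ 𝓝 μ)
    (hA : MeasurableSet[borel (Prob d)] A) :
    ∃ p : ℝ, 0 < p ∧ ∀ᶠ N : ℕ in atTop, ENNReal.ofReal (Real.exp (-(β N * k)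
      + (Real.log p - N * Real.log B)))
      ≤ ∫⁻ x in {x : Fin N → Space d | empirical x ∈ A}, weight V W (β N) N x := by
  obtain ⟨q, hq, hqN⟩ := h.eventually_pi_lt hR hk
  -- Eventually `q` plus the vanishing probability of missing `A` stays below `r < 1`, so both
  -- constraints hold together with probability at least `1 - r`.
  obtain ⟨r, hqr, hr1⟩ := exists_between hq
  have hrt : r ≠ ⊤ := (hr1.trans ENNReal.one_lt_top).ne
  have hp : 0 < 1 - r.toReal := by
    have := (ENNReal.toReal_lt_toReal hrt ENNReal.one_ne_top).2 hr1
    simp at this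
    linarith
  refine ⟨1 - r.toReal, hp, ?_⟩
  have hlim := (tendsto_pi_empirical_notMem hAμ).add_const q
  rw [zero_add] at hlim
  filter_upwards [hqN, hlim.eventually (gt_mem_nhds hqr), eventually_ne_atTop 0] with N h1 h2 hN0
  set P := Measure.pi (fun _ : Fin N => (μ : Measure (Space d))) with hP
  set S : Set (Fin N → Space d) := {x | empirical x ∈ A} ∩ {x | hamiltonian V W N x ≤ (k : EReal)}
    with hS
  have hSm : MeasurableSet S :=
    (measurable_empirical hA).inter (measurableSet_le (h.measurable_hamiltonian hN0) measurable_const)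
  have hSc : P Sᶜ ≤ r := by
    rw [hS, Set.compl_inter]
    calc _ ≤ _ := measure_union_le _ _
      _ ≤ _ := add_le_add le_rfl h1
      _ ≤ r := h2.le
  have hPS : ENNReal.ofReal (1 - r.toReal) ≤ P S := by
    rw [ENNReal.ofReal_sub _ ENNReal.toReal_nonneg, ENNReal.ofReal_toReal hrt, ENNReal.ofReal_one,
      ← compl_compl S, prob_compl_eq_one_sub hSm.compl]
    gcongr
  have hvol : P S ≤ (B ^ N : NNReal) * volume S := by
    have := pi_le_smul_volume hB N S
    rwa [Measure.smul_apply, ENNReal.smul_def, smul_eq_mul] at this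
  have hBpos : (0 : ℝ) < B := by exact_mod_cast pos_iff_ne_zero.2 hB0
  have hBN : Real.exp (Real.log (1 - r.toReal) - N * Real.log B) * B ^ N = 1 - r.toReal := by
    rw [Real.exp_sub, Real.exp_log hp, Real.exp_nat_mul, Real.exp_log hBpos]
    field_simp
  -- Probability is converted into Lebesgue volume at the price of a factor `B^{-N}`.
  have hvol2 : ENNReal.ofReal (Real.exp (Real.log (1 - r.toReal) - N * Real.log B)) ≤ volume S := by
    have hne : ((B ^ N : NNReal) : ℝ≥0∞) ≠ 0 := by exact_mod_cast pow_ne_zero N hB0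
    rw [← ENNReal.mul_le_mul_iff_right hne ENNReal.coe_ne_top]
    refine le_trans (le_of_eq ?_) (hPS.trans hvol)
    rw [← ENNReal.ofReal_coe_nnreal, ← ENNReal.ofReal_mul (by positivity), mul_comm,
      NNReal.coe_pow, hBN]
  calc _ = ENNReal.ofReal (Real.exp (-(β N * k)))
        * ENNReal.ofReal (Real.exp (Real.log (1 - r.toReal) - N * Real.log B)) := by
        rw [Real.exp_add, ENNReal.ofReal_mul (Real.exp_pos _).le]
    _ ≤ ENNReal.ofReal (Real.exp (-(β N * k))) * volume S := by gcongr
    _ = ∫⁻ _ in S, ENNReal.ofReal (Real.exp (-(β N * k))) := (setLIntegral_const _ _).symm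
    _ ≤ ∫⁻ x in S, weight V W (β N) N x := by
        refine setLIntegral_mono' hSm fun x hx => ?_
        rw [weight, ← EReal.exp_coe, EReal.exp_le_exp_iff, EReal.coe_neg, EReal.neg_le_neg_iff,
          EReal.coe_mul]
        exact mul_le_mul_of_nonneg_left hx.2 (by exact_mod_cast (hpos N).le)
    _ ≤ _ := lintegral_mono_set Set.inter_subset_left

/-- Absolutely continuous measures are approximated, with their energy, by measures with bounded
density on which `V` is bounded. -/
theorem exists_bounded_density (h : Confined V W m b κ) {μ : Prob d}
    (hμ : (μ : Measure (Space d)) ≪ volume) {k : ℝ} (hk : energy V W μ < (k : EReal))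
    {A : Set (Prob d)} (hA : A ∈ 𝓝 μ) :
    ∃ ν : Prob d, ν ∈ interior A ∧ energy V W ν < (k : EReal) ∧
      (∃ B : NNReal, B ≠ 0 ∧ (ν : Measure (Space d)) ≤ B • volume) ∧
      ∃ R : ℝ, ∀ᵐ x ∂(ν : Measure (Space d)), V x ≤ R := by
  set f := (μ : Measure (Space d)).rnDeriv volume with hf
  have hfm : Measurable f := Measure.measurable_rnDeriv _ _
  have hfμ : (volume : Measure (Space d)).withDensity f = μ := Measure.withDensity_rnDeriv_eq _ _ hμ
  -- The approximants are `μ` conditioned on these increasing sets, which exhaust `μ`-almost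
  -- everything.
  set E : ℕ → Set (Space d) := fun n => {x | f x ≤ n} ∩ {x | V x ≤ n} with hE
  have hEm : ∀ n, MeasurableSet (E n) := fun n =>
    (measurableSet_le hfm measurable_const).inter
      (measurableSet_le h.hV.continuous.measurable measurable_const)
  have hEmono : Monotone E := by
    intro i j hij x hx
    exact ⟨(show f x ≤ i from hx.1).trans (by exact_mod_cast hij),
      (show V x ≤ i from hx.2).trans (by exact_mod_cast hij)⟩
  have hEU : ⋃ n, E n =ᵐ[(μ : Measure (Space d))] Set.univ := by
    rw [eventuallyEq_univ]
    filter_upwards [hμ.ae_le (Measure.rnDeriv_lt_top (μ : Measure (Space d)) volume)] with x hx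
    obtain ⟨n₁, hn₁⟩ := ENNReal.exists_nat_gt hx.ne
    obtain ⟨n₂, hn₂⟩ := exists_nat_ge (V x)
    refine Set.mem_iUnion.2 ⟨max n₁ n₂, hn₁.le.trans ?_, hn₂.trans ?_⟩
    · exact_mod_cast le_max_left _ _
    · exact_mod_cast le_max_right _ _
  have hμE : Tendsto (fun n => (μ : Measure (Space d)) (E n)) atTop (𝓝 1) := by
    have := tendsto_measure_iUnion_atTop (μ := (μ : Measure (Space d))) hEmono
    rwa [measure_congr hEU, measure_univ] at this
  have hcond : ∀ n, ∃ ν : Prob d, (μ : Measure (Space d)) (E n) ≠ 0 →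
      (ν : Measure (Space d))
        = ((μ : Measure (Space d)) (E n))⁻¹ • (μ : Measure (Space d)).restrict (E n) := by
    intro n
    by_cases hn : (μ : Measure (Space d)) (E n) = 0
    -- An arbitrary value for null `E n`, which no longer occur for large `n`.
    · exact ⟨μ, fun h => absurd hn h⟩
    · exact ⟨⟨ProbabilityTheory.cond (μ : Measure (Space d)) (E n),
        ProbabilityTheory.cond_isProbabilityMeasure hn⟩, fun _ => rfl⟩
  choose ν hν' using hcond
  have hν : ∀ᶠ n in atTop, (μ : Measure (Space d)) (E n) ≠ 0 ∧ (ν n : Measure (Space d))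
      = ((μ : Measure (Space d)) (E n))⁻¹ • (μ : Measure (Space d)).restrict (E n) :=
    (hμE.eventually_ne one_ne_zero).mono fun n hn => ⟨hn, hν' n hn⟩
  have hinv : Tendsto (fun n => ((μ : Measure (Space d)) (E n))⁻¹) atTop (𝓝 1) := by
    simpa using tendsto_inv_iff.2 hμE
  have hweak : Tendsto ν atTop (𝓝 μ) := by
    rw [ProbabilityMeasure.tendsto_iff_forall_integral_tendsto]
    intro g
    have h1 : Tendsto (fun n => ∫ x in E n, g x ∂(μ : Measure (Space d))) atTop
        (𝓝 (∫ x, g x ∂(μ : Measure (Space d)))) := by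
      have := tendsto_setIntegral_of_monotone hEm hEmono
        (g.integrable (μ : Measure (Space d))).integrableOn
      rwa [Measure.restrict_congr_set hEU, Measure.restrict_univ] at this
    have h2 : Tendsto (fun n => (((μ : Measure (Space d)) (E n))⁻¹).toReal) atTop (𝓝 1) := by
      exact (ENNReal.tendsto_toReal ENNReal.one_ne_top).comp hinv
    have h3 := h2.mul h1
    rw [one_mul] at h3
    refine h3.congr' ?_
    filter_upwards [hν] with n hn
    rw [hn.2, integral_smul_measure, smul_eq_mul]
  set G := ∫⁻ p, gap V W b p ∂((μ : Measure (Space d)).prod (μ : Measure (Space d))) with hG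
  -- Only an upper bound on the energy is needed: restricting the nonnegative gap lowers its
  -- integral, and the normalization costs `μ(E n)⁻²`, which tends to `1`.
  have hEn : Tendsto (fun n => halfShift b (((μ : Measure (Space d)) (E n))⁻¹ *
      (((μ : Measure (Space d)) (E n))⁻¹ * G))) atTop (𝓝 (energy V W μ)) := by
    rw [h.energy_eq, ← hG]
    refine ((continuous_halfShift b).tendsto _).comp ?_
    have h1 : Tendsto (fun n => ((μ : Measure (Space d)) (E n))⁻¹ * G) atTop (𝓝 (1 * G)) :=
      ENNReal.Tendsto.mul_const hinv (Or.inl one_ne_zero)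
    have h2 := ENNReal.Tendsto.mul hinv (Or.inl one_ne_zero) h1 (Or.inr ENNReal.one_ne_top)
    simpa using h2
  obtain ⟨n, hn1, ⟨hn2, hn3⟩, hn4, hn5⟩ := ((hweak.eventually (interior_mem_nhds.2 hA)).and
    (hν.and ((hEn.eventually (gt_mem_nhds hk)).and (eventually_ge_atTop 1)))).exists
  refine ⟨ν n, hn1, ?_, ⟨(n : NNReal) * ((μ : Measure (Space d)) (E n))⁻¹.toNNReal, ?_, ?_⟩, n, ?_⟩
  · refine lt_of_le_of_lt ?_ hn4
    rw [h.energy_eq, hn3]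
    refine monotone_halfShift b ?_
    rw [Measure.prod_smul_left, Measure.prod_smul_right, lintegral_smul_measure,
      lintegral_smul_measure, Measure.prod_restrict, smul_eq_mul, smul_eq_mul]
    gcongr
    exact setLIntegral_le_lintegral _ _
  · refine mul_ne_zero (by exact_mod_cast (by omega : n ≠ 0)) ?_
    rw [ENNReal.toNNReal_ne_zero]
    exact ⟨by simp, by simpa using hn2⟩
  · rw [hn3, Measure.le_iff]
    intro s hs
    have h1 : (μ : Measure (Space d)).restrict (E n) s ≤ n * volume s := by
      rw [Measure.restrict_apply hs, ← hfμ, withDensity_apply _ (hs.inter (hEm n))]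
      calc ∫⁻ x in s ∩ E n, f x ≤ ∫⁻ _ in s ∩ E n, (n : ℝ≥0∞) :=
            setLIntegral_mono' (hs.inter (hEm n)) fun x hx => hx.2.1
        _ = n * volume (s ∩ E n) := setLIntegral_const _ _
        _ ≤ _ := by gcongr; exact Set.inter_subset_left
    rw [Measure.smul_apply, Measure.smul_apply, ENNReal.smul_def, smul_eq_mul, smul_eq_mul,
      ENNReal.coe_mul, ENNReal.coe_toNNReal (by simpa using hn2), ENNReal.coe_natCast,
      mul_comm (n : ℝ≥0∞), mul_assoc]
    gcongr
  · rw [hn3]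
    refine Measure.ae_smul_measure ?_ _
    exact (ae_restrict_mem (hEm n)).mono fun x hx => hx.2

theorem le_liminf_lintegral_weight (h : Confined V W m b κ) {β : ℕ → ℝ} (hpos : ∀ N, 0 < β N)
    (hβ : Tendsto (fun N : ℕ => (N : ℝ) / β N) atTop (𝓝 0)) {A : Set (Prob d)}
    (hA : MeasurableSet[borel (Prob d)] A) :
    -(⨅ μ ∈ {μ : Prob d | μ ∈ interior A ∧ (μ : Measure (Space d)) ≪ volume}, energy V W μ)
      ≤ liminf (fun N : ℕ => ENNReal.log (∫⁻ x in {x : Fin N → Space d | empirical x ∈ A},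
        weight V W (β N) N x) / (β N : EReal)) atTop := by
  rw [EReal.neg_le]
  refine le_iInf₂ fun μ hμ => ?_
  refine EReal.le_of_forall_lt_iff_le.1 fun k hk => ?_
  rw [EReal.neg_le]
  obtain ⟨ν, hνA, hνk, ⟨B, hB0, hB⟩, R, hR⟩ :=
    h.exists_bounded_density hμ.2 hk (mem_interior_iff_mem_nhds.1 hμ.1)
  obtain ⟨p, hp, hpN⟩ := h.exists_le_lintegral_weight hB0 hB hR hνk hpos
    (mem_interior_iff_mem_nhds.1 hνA) hA
  have hinv : Tendsto (fun N : ℕ => 1 / β N) atTop (𝓝 0) := by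
    refine squeeze_zero' (Eventually.of_forall fun N => (by have := hpos N; positivity)) ?_ hβ
    filter_upwards [eventually_ge_atTop 1] with N hN
    have := hpos N
    gcongr
    exact_mod_cast hN
  have hlim : Tendsto (fun N : ℕ =>
      ((-k + (Real.log p * (1 / β N) - (N / β N) * Real.log B) : ℝ) : EReal)) atTop
      (𝓝 (-(k : EReal))) := by
    rw [← EReal.coe_neg, EReal.tendsto_coe]
    simpa using ((hinv.const_mul (Real.log p)).sub (hβ.mul_const (Real.log B))).const_add (-k)
  rw [← hlim.liminf_eq]
  refine liminf_le_liminf ?_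
  filter_upwards [hpN] with N hN
  refine le_trans (le_of_eq ?_) (le_log_div (hpos N) hN)
  congr 1
  have := (hpos N).ne'
  field_simp

end Confined

/-! ### Normalized constants and a measure of finite energy -/

theorem exists_confined (h1 : H1 W) (h2 : H2 V) (h3 : H3 V W) :
    ∃ m b κ : ℝ, Confined V W m b κ := by
  obtain ⟨c, ε, hε0, hε1, hc⟩ := h3
  obtain ⟨x₀, hx₀⟩ := h2.continuous.exists_forall_le h2.tendsto
  -- With `m = min V` and `κ = 1 - ε`, the choice `b = c + 2κm` makes the coercivity bound identical
  -- to (H3).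
  refine ⟨V x₀, c + 2 * (1 - ε) * V x₀, 1 - ε, h2, h1, hx₀, by linarith, by linarith, fun x y => ?_⟩
  refine le_trans (le_of_eq ?_) (hc x y)
  congr 1
  ring

/-- By compactness the supremum is attained, at a pair at distance at least `‖x - y‖ > 0`. It is
therefore finite, and `toReal` loses nothing. -/
theorem le_supAway_sub (h1 : H1 W) {K : Set (Space d)} (hK : IsCompact K) {x y : Space d}
    (hx : x ∈ K) (hy : y ∈ K) (hxy : x ≠ y) :
    W x y ≤ ((supAway W K (x - y)).toReal : EReal) := by
  have hle : W x y ≤ supAway W K (x - y) := le_sSup ⟨x, hx, y, hy, le_rfl, rfl⟩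
  have hcomp : IsCompact {p : Space d × Space d | p ∈ K ×ˢ K ∧ ‖x - y‖ ≤ ‖p.1 - p.2‖} :=
    (hK.prod hK).inter_right (isClosed_le continuous_const
      (continuous_fst.sub continuous_snd).norm)
  obtain ⟨p, hp, hmax⟩ := hcomp.exists_isMaxOn ⟨(x, y), ⟨hx, hy⟩, le_rfl⟩ h1.continuous.continuousOn
  have hp12 : p.1 ≠ p.2 := by
    intro h
    have h2 : ‖x - y‖ ≤ ‖p.1 - p.2‖ := hp.2
    rw [h, sub_self, norm_zero] at h2
    exact hxy (sub_eq_zero.1 (norm_le_zero_iff.1 h2))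
  have htop : supAway W K (x - y) ≠ ⊤ := by
    refine ne_top_of_le_ne_top (h1.ne_top _ _ hp12) (sSup_le ?_)
    rintro w ⟨x', hx', y', hy', hz, rfl⟩
    exact hmax (show (x', y') ∈ _ from ⟨⟨hx', hy'⟩, hz⟩)
  have hbot : supAway W K (x - y) ≠ ⊥ := fun h => h1.ne_bot x y (le_bot_iff.1 (h ▸ hle))
  rwa [EReal.coe_toReal htop hbot]

namespace Confined

/-- The uniform law on the unit ball works: off the diagonal the gap is bounded by a function of `x
- y`, integrable on the ball of radius `2` by (H1), and translation invariance bounds the inner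
integral uniformly in `x`. The assumption `1 ≤ d` makes points Lebesgue-null. -/
theorem exists_energy_lt_top (h : Confined V W m b κ) (hd : 1 ≤ d) :
    ∃ μ : Prob d, (μ : Measure (Space d)) ≪ volume ∧ energy V W μ < ⊤ := by
  have : Nonempty (Fin d) := ⟨⟨0, hd⟩⟩
  set K : Set (Space d) := Metric.closedBall 0 1 with hKdef
  have hK : IsCompact K := isCompact_closedBall 0 1
  have hv0 : volume K ≠ 0 := (Metric.measure_closedBall_pos volume _ one_pos).ne'
  have hvt : volume K ≠ ⊤ := hK.measure_lt_top.ne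
  set B := volume K with hB
  have hKprob : IsProbabilityMeasure (B⁻¹ • (volume : Measure (Space d)).restrict K) := by
    constructor
    rw [Measure.smul_apply, Measure.restrict_apply_univ, smul_eq_mul]
    exact ENNReal.inv_mul_cancel hv0 hvt
  set ν := B⁻¹ • (volume : Measure (Space d)).restrict K with hν
  obtain ⟨μ, hμ⟩ : ∃ μ : Prob d, (μ : Measure (Space d)) = ν := ⟨⟨ν, hKprob⟩, rfl⟩
  refine ⟨μ, ?_, ?_⟩
  · rw [hμ]
    exact (Measure.smul_absolutelyContinuous).trans Measure.restrict_le_self.absolutelyContinuous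
  obtain ⟨R, hR⟩ := (hK.bddAbove_image h.hV.continuous.continuousOn)
  have hR' : ∀ x ∈ K, V x ≤ R := fun x hx => hR ⟨x, hx, rfl⟩
  set S : Space d → ℝ := fun z => (supAway W K z).toReal with hS
  set F : Space d → ℝ≥0∞ := fun z => ENNReal.ofReal (2 * R - b) + ‖S z‖ₑ with hF
  have hFint : ∫⁻ z in Metric.closedBall 0 2, F z ≠ ⊤ := by
    have hSi := (h.hW.locallyIntegrable K hK).integrableOn_isCompact
      (isCompact_closedBall (0 : Space d) 2)
    rw [hF, lintegral_add_left measurable_const]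
    refine ENNReal.add_ne_top.2 ⟨?_, hSi.2.ne⟩
    rw [setLIntegral_const]
    exact ENNReal.mul_ne_top ENNReal.ofReal_ne_top
      (isCompact_closedBall (0 : Space d) 2).measure_lt_top.ne
  have hgap : ∀ x ∈ K, ∀ y ∈ K, x ≠ y → gap V W b (x, y) ≤ F (x - y) := by
    intro x hx y hy hxy
    have h1 : ((V x + V y - b : ℝ) : EReal) + W x y ≤ ((2 * R - b + S (x - y) : ℝ) : EReal) := by
      calc _ ≤ ((V x + V y - b : ℝ) : EReal) + (S (x - y) : EReal) :=
            add_le_add le_rfl (le_supAway_sub h.hW hK hx hy hxy)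
        _ ≤ _ := by
          rw [← EReal.coe_add, EReal.coe_le_coe_iff]
          linarith [hR' x hx, hR' y hy]
    calc gap V W b (x, y) ≤ ((2 * R - b + S (x - y) : ℝ) : EReal).toENNReal :=
          EReal.toENNReal_le_toENNReal h1
      _ = ENNReal.ofReal (2 * R - b + S (x - y)) := by
          rw [EReal.toENNReal_of_ne_top (EReal.coe_ne_top _), EReal.toReal_coe]
      _ ≤ _ := ENNReal.ofReal_add_le
      _ ≤ _ := by
          simp only [hF, Real.enorm_eq_ofReal_abs]
          gcongr
          exact le_abs_self _
  have hinner : ∀ x ∈ K, ∫⁻ y, gap V W b (x, y) ∂ν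
      ≤ B⁻¹ * ∫⁻ z in Metric.closedBall 0 2, F z := by
    intro x hx
    rw [hν, lintegral_smul_measure, smul_eq_mul]
    refine mul_le_mul_right ?_ _
    calc ∫⁻ y in K, gap V W b (x, y)
        ≤ ∫⁻ y in K, (Metric.closedBall (0 : Space d) 2).indicator F (x - y) := by
          refine setLIntegral_mono_ae' hK.measurableSet ?_
          have hne : ∀ᵐ y ∂(volume : Measure (Space d)), y ≠ x := by
            simp [ae_iff]
          filter_upwards [hne] with y hyx hy
          have hmem : x - y ∈ Metric.closedBall (0 : Space d) 2 := by
            have hx1 : ‖x‖ ≤ 1 := by simpa [hKdef] using hx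
            have hy1 : ‖y‖ ≤ 1 := by simpa [hKdef] using hy
            rw [mem_closedBall_zero_iff]
            linarith [norm_sub_le x y]
          rw [Set.indicator_of_mem hmem]
          exact hgap x hx y hy hyx.symm
      _ ≤ ∫⁻ y, (Metric.closedBall (0 : Space d) 2).indicator F (x - y) :=
          setLIntegral_le_lintegral _ _
      _ = ∫⁻ z, (Metric.closedBall (0 : Space d) 2).indicator F z :=
          lintegral_sub_left_eq_self _ x
      _ = _ := lintegral_indicator Metric.isClosed_closedBall.measurableSet _
  rw [h.energy_eq, halfShift_lt_top_iff, hμ, lintegral_prod _ h.continuous_gap.measurable.aemeasurable]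
  have hae : ∀ᵐ x ∂ν, x ∈ K := Measure.ae_smul_measure (ae_restrict_mem hK.measurableSet) _
  calc ∫⁻ x, ∫⁻ y, gap V W b (x, y) ∂ν ∂ν
      ≤ ∫⁻ _, (B⁻¹ * ∫⁻ z in Metric.closedBall 0 2, F z) ∂ν :=
        lintegral_mono_ae (hae.mono hinner)
    _ = B⁻¹ * ∫⁻ z in Metric.closedBall 0 2, F z := by simp
    _ < ⊤ := (ENNReal.mul_ne_top (ENNReal.inv_ne_top.2 hv0) hFint).lt_top

theorem exists_iInf_energy_eq (h : Confined V W m b κ) (hd : 1 ≤ d) :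
    ∃ i₀ : ℝ, ⨅ μ : Prob d, energy V W μ = (i₀ : EReal) := by
  obtain ⟨μ, -, hμ⟩ := h.exists_energy_lt_top hd
  exact ⟨_, (EReal.coe_toReal ((iInf_le _ μ).trans_lt hμ).ne h.bot_lt_iInf_energy.ne').symm⟩

end Confined

/-! ### Weak neighbourhoods and the Fortet–Mourier distance -/

theorem dFM_nonneg (μ ν : Prob d) : 0 ≤ dFM μ ν :=
  Real.sSup_nonneg' ⟨0, ⟨fun _ => 0, by simp, LipschitzWith.const' 0, by simp⟩, le_rfl⟩

theorem dFMSet_nonneg (μ : Prob d) (S : Set (Prob d)) : 0 ≤ dFMSet μ S := by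
  refine Real.sInf_nonneg ?_
  rintro _ ⟨ν, -, rfl⟩
  exact dFM_nonneg μ ν

theorem dFMSet_le {μ ν : Prob d} {S : Set (Prob d)} (hν : ν ∈ S) : dFMSet μ S ≤ dFM μ ν := by
  refine csInf_le ⟨0, ?_⟩ ⟨ν, hν, rfl⟩
  rintro _ ⟨ν, -, rfl⟩
  exact dFM_nonneg μ ν

theorem integrableOn_measureReal_of_antitone {α : Type*} [MeasurableSpace α] (ν : Measure α)
    [IsProbabilityMeasure ν] {s : ℝ → Set α} (hs : Antitone s) (M : ℝ) :
    IntegrableOn (fun t => ν.real (s t)) (Set.Ioc 0 M) := by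
  refine Measure.integrableOn_of_bounded (M := 1) measure_Ioc_lt_top.ne ?_ ?_
  · have h : Antitone fun t => ν (s t) := fun _ _ hst => measure_mono (hs hst)
    exact h.measurable.ennreal_toReal.aestronglyMeasurable
  · refine Eventually.of_forall fun t => ?_
    rw [Real.norm_of_nonneg measureReal_nonneg]
    exact measureReal_le_one

/-- Layer cake for `g = f + 1`, with values in `[0, 2]`. The Lévy–Prokhorov bound costs `δ ‖g‖ ≤
2δ`, and the Lipschitz property puts the thickened level sets inside those of `g + δ`, which costs
one more `δ`. -/
theorem integral_sub_le_of_levyProkhorovEDist_lt {μ ν : Prob d} {δ : ℝ} (hδ : 0 < δ)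
    (hμν : levyProkhorovEDist (μ : Measure (Space d)) ν < ENNReal.ofReal δ) {f : Space d → ℝ}
    (hf1 : ∀ x, |f x| ≤ 1) (hf : LipschitzWith 1 f) :
    (∫ x, f x ∂(μ : Measure (Space d))) - ∫ x, f x ∂(ν : Measure (Space d)) ≤ 3 * δ := by
  have hg0 : ∀ x, 0 ≤ f x + 1 := fun x => by linarith [neg_le_of_abs_le (hf1 x)]
  have hg2 : ∀ x, ‖f x + 1‖ ≤ 2 := fun x => by
    rw [Real.norm_of_nonneg (hg0 x)]
    linarith [le_of_abs_le (hf1 x)]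
  let g : BoundedContinuousFunction (Space d) ℝ :=
    BoundedContinuousFunction.ofNormedAddCommGroup (fun x => f x + 1)
      (hf.continuous.add continuous_const) 2 hg2
  have hgx : ∀ x, g x = f x + 1 := fun x => rfl
  have hgn : ‖g‖ ≤ 2 := (BoundedContinuousFunction.norm_le (by norm_num)).2 hg2
  have hfi : ∀ ρ : Prob d, Integrable f (ρ : Measure (Space d)) := fun ρ =>
    Integrable.of_bound hf.continuous.aestronglyMeasurable 1 (Eventually.of_forall hf1)
  have hgi : ∀ ρ : Prob d, ∫ x, g x ∂(ρ : Measure (Space d))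
      = ∫ x, f x ∂(ρ : Measure (Space d)) + 1 := by
    intro ρ
    simp_rw [hgx]
    rw [integral_add (hfi ρ) (integrable_const _)]
    simp
  have key := BoundedContinuousFunction.integral_le_of_levyProkhorovEDist_lt
    (μ : Measure (Space d)) (ν : Measure (Space d)) hδ hμν g (Eventually.of_forall hg0)
  have hanti : ∀ M : ℝ, IntegrableOn
      (fun t => (ν : Measure (Space d)).real {x | t ≤ g x + δ}) (Set.Ioc 0 M) := by
    refine integrableOn_measureReal_of_antitone _ fun s t hst x hx => ?_
    exact hst.trans (show t ≤ g x + δ from hx)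
  have hanti' : IntegrableOn
      (fun t => (ν : Measure (Space d)).real (Metric.thickening δ {x | t ≤ g x})) (Set.Ioc 0 ‖g‖) := by
    refine integrableOn_measureReal_of_antitone _ (fun s t hst => ?_) _
    exact Metric.thickening_subset_of_subset δ fun x hx => hst.trans (show t ≤ g x from hx)
  have hle : ∫ t in Set.Ioc 0 ‖g‖, (ν : Measure (Space d)).real (Metric.thickening δ {x | t ≤ g x})
      ≤ ∫ x, (g x + δ) ∂(ν : Measure (Space d)) := by
    calc _ ≤ ∫ t in Set.Ioc 0 ‖g‖, (ν : Measure (Space d)).real {x | t ≤ g x + δ} := by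
          refine setIntegral_mono hanti' (hanti _) fun t => measureReal_mono fun x hx => ?_
          obtain ⟨y, hy, hxy⟩ := Metric.mem_thickening_iff.1 hx
          have hy' : t ≤ f y + 1 := hy
          have h1 := hf.dist_le_mul y x
          rw [Real.dist_eq, NNReal.coe_one, one_mul, dist_comm] at h1
          change t ≤ f x + 1 + δ
          linarith [le_abs_self (f y - f x)]
      _ ≤ ∫ t in Set.Ioc 0 (‖g‖ + δ), (ν : Measure (Space d)).real {x | t ≤ g x + δ} :=
          setIntegral_mono_set (hanti _) (Eventually.of_forall fun _ => measureReal_nonneg)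
            (Eventually.of_forall (Set.Ioc_subset_Ioc_right (by linarith)))
      _ = _ := by
          refine (Integrable.integral_eq_integral_Ioc_meas_le
            ((g.integrable _).add (integrable_const _)) (Eventually.of_forall fun x => ?_)
            (Eventually.of_forall fun x => ?_)).symm
          · exact add_nonneg (hg0 x) hδ.le
          · exact add_le_add ((le_abs_self _).trans (g.norm_coe_le_norm x)) le_rfl
  rw [integral_add (g.integrable _) (integrable_const _), hgi] at hle
  rw [hgi] at key
  simp only [integral_const, probReal_univ, smul_eq_mul, one_mul] at hle
  have : δ * ‖g‖ ≤ δ * 2 := by gcongr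
  linarith

theorem dFM_lt_mem_nhds (ν : Prob d) {ε : ℝ} (hε : 0 < ε) : {μ | dFM μ ν < ε} ∈ 𝓝 ν := by
  have hc := (LevyProkhorov.continuous_ofMeasure_probabilityMeasure (Ω := Space d)).tendsto ν
  have hball := hc.eventually (Metric.eball_mem_nhds (LevyProkhorov.ofMeasure ν)
    (ENNReal.ofReal_pos.2 (show 0 < ε / 6 by linarith)))
  filter_upwards [hball] with μ hμ
  have hμ' : levyProkhorovEDist (μ : Measure (Space d)) ν < ENNReal.ofReal (ε / 6) := hμ
  refine lt_of_le_of_lt (csSup_le ⟨0, fun _ => 0, by simp, LipschitzWith.const' 0, by simp⟩ ?_)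
    (show ε / 2 < ε by linarith)
  rintro _ ⟨f, hf1, hf, rfl⟩
  have := integral_sub_le_of_levyProkhorovEDist_lt (by linarith) hμ' hf1 hf
  linarith

/-! ### Normalization and growth of the inverse temperature -/

theorem isProbabilityMeasure_gibbs {β : ℝ} {N : ℕ} (h0 : 0 < partitionFn V W β N)
    (ht : partitionFn V W β N < ⊤) : IsProbabilityMeasure (gibbs V W β N) := by
  constructor
  rw [gibbs, withDensity_apply _ MeasurableSet.univ, Measure.restrict_univ]
  simp_rw [div_eq_mul_inv]
  rw [lintegral_mul_const' _ _ (ENNReal.inv_ne_top.2 h0.ne')]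
  exact ENNReal.mul_inv_cancel h0.ne' ht.ne

theorem empiricalProb_eq {β : ℝ} {N : ℕ} (h0 : 0 < partitionFn V W β N) {A : Set (Prob d)}
    (hA : MeasurableSet[borel (Prob d)] A) :
    empiricalProb V W β N A = (∫⁻ x in {x : Fin N → Space d | empirical x ∈ A}, weight V W β N x)
      * (partitionFn V W β N)⁻¹ := by
  rw [empiricalProb, gibbs, withDensity_apply _ (measurable_empirical hA)]
  simp_rw [div_eq_mul_inv]
  rw [lintegral_mul_const' _ _ (ENNReal.inv_ne_top.2 h0.ne')]

theorem partitionFn_mul_empiricalProb {β : ℝ} {N : ℕ} (h0 : 0 < partitionFn V W β N)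
    (ht : partitionFn V W β N < ⊤) {A : Set (Prob d)} (hA : MeasurableSet[borel (Prob d)] A) :
    partitionFn V W β N * empiricalProb V W β N A
      = ∫⁻ x in {x : Fin N → Space d | empirical x ∈ A}, weight V W β N x := by
  rw [empiricalProb_eq h0 hA, mul_left_comm, ENNReal.mul_inv_cancel h0.ne' ht.ne, mul_one]

/-- `log Z_N` is a real number, so the splitting is legitimate even where the other logarithm is
`-∞`. -/
theorem log_empiricalProb_div {β : ℝ} {N : ℕ} (hβ : 0 < β) (h0 : 0 < partitionFn V W β N)
    (ht : partitionFn V W β N < ⊤) {A : Set (Prob d)} (hA : MeasurableSet[borel (Prob d)] A) :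
    ENNReal.log (empiricalProb V W β N A) / (β : EReal)
      = ENNReal.log (partitionFn V W β N * empiricalProb V W β N A) / (β : EReal)
        + -(ENNReal.log (partitionFn V W β N) / (β : EReal)) := by
  have h1 : empiricalProb V W β N A
      = (partitionFn V W β N * empiricalProb V W β N A) * (partitionFn V W β N)⁻¹ := by
    rw [partitionFn_mul_empiricalProb h0 ht hA, ← empiricalProb_eq h0 hA]
  nth_rewrite 1 [h1]
  rw [ENNReal.log_mul_add, ENNReal.log_inv]
  have h2 : ∃ z : ℝ, ENNReal.log (partitionFn V W β N) = (z : EReal) :=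
    ⟨_, ENNReal.log_pos_real h0.ne' ht.ne⟩
  obtain ⟨z, hz⟩ := h2
  rw [hz, ← EReal.coe_neg, ← EReal.coe_div, ← EReal.coe_neg]
  have hβ' : (0 : EReal) < β := by exact_mod_cast hβ
  induction ENNReal.log (partitionFn V W β N * empiricalProb V W β N A) with
  | bot => rw [EReal.bot_add, EReal.bot_div_of_pos_ne_top hβ' (EReal.coe_ne_top _), EReal.bot_add]
  | top =>
    rw [EReal.top_add_coe, EReal.top_div_of_pos_ne_top hβ' (EReal.coe_ne_top _), EReal.top_add_coe]
  | coe q =>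
    rw [← EReal.coe_add, ← EReal.coe_div, ← EReal.coe_div, ← EReal.coe_add]
    congr 1
    ring

theorem tendsto_div_of_mul_log {β : ℕ → ℝ}
    (hβ : Tendsto (fun N : ℕ => β N / ((N : ℝ) * Real.log N)) atTop atTop) (hpos : ∀ N, 0 < β N) :
    Tendsto (fun N : ℕ => (N : ℝ) / β N) atTop (𝓝 0) := by
  have hlog : Tendsto (fun N : ℕ => (Real.log N)⁻¹) atTop (𝓝 0) :=
    tendsto_inv_atTop_zero.comp (Real.tendsto_log_atTop.comp tendsto_natCast_atTop_atTop)
  refine squeeze_zero' (Eventually.of_forall fun N => ?_) ?_ hlog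
  · have := hpos N
    positivity
  · filter_upwards [hβ.eventually_ge_atTop 1, eventually_ge_atTop 2] with N hN hN2
    have h1 : (1 : ℝ) < N := by exact_mod_cast hN2
    have hl := Real.log_pos h1
    rw [le_div_iff₀ (by positivity), one_mul] at hN
    rw [div_le_iff₀ (hpos N), inv_mul_eq_div, le_div_iff₀ hl]
    exact hN

/-- Supplies the summable bound for Borel–Cantelli: once `c β_N ≥ 2 N log N`, a fortiori `c β_N ≥ 2
log N`. -/
theorem eventually_exp_neg_le {β : ℕ → ℝ}
    (hβ : Tendsto (fun N : ℕ => β N / ((N : ℝ) * Real.log N)) atTop atTop) {c : ℝ} (hc : 0 < c) :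
    ∀ᶠ N : ℕ in atTop, Real.exp (-(c * β N)) ≤ 1 / (N : ℝ) ^ 2 := by
  filter_upwards [hβ.eventually_ge_atTop (2 / c), eventually_ge_atTop 2] with N hN hN2
  have h1 : (1 : ℝ) < N := by exact_mod_cast hN2
  have hl := Real.log_pos h1
  rw [le_div_iff₀ (by positivity), div_mul_eq_mul_div, div_le_iff₀ hc] at hN
  have h2 : 2 * Real.log N ≤ c * β N := by nlinarith
  calc Real.exp (-(c * β N)) ≤ Real.exp (-(2 * Real.log N)) := Real.exp_le_exp.2 (by linarith)
    _ = 1 / (N : ℝ) ^ 2 := by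
      rw [Real.exp_neg, ← Nat.cast_ofNat, Real.exp_nat_mul, Real.exp_log (by linarith), one_div]

theorem rate_add {i₀ : ℝ} (hi : ⨅ μ : Prob d, energy V W μ = (i₀ : EReal)) (μ : Prob d) :
    rate V W μ + (i₀ : EReal) = energy V W μ := by
  rw [rate, hi, EReal.sub_add_cancel]

theorem rate_eq_zero_iff {i₀ : ℝ} (hi : ⨅ μ : Prob d, energy V W μ = (i₀ : EReal)) (μ : Prob d) :
    rate V W μ = 0 ↔ energy V W μ = (i₀ : EReal) := by
  constructor
  · intro h
    rw [← rate_add hi, h, zero_add]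
  · intro h
    rw [rate, h, hi, EReal.sub_self (EReal.coe_ne_top _) (EReal.coe_ne_bot _)]

/-- The infimum of the energy over the absolutely continuous measures of an open set. -/
theorem iInf_absolutelyContinuous_eq (h4 : H4 V W) {U : Set (Prob d)} (hU : IsOpen U) :
    ⨅ μ ∈ {μ : Prob d | μ ∈ U ∧ (μ : Measure (Space d)) ≪ volume}, energy V W μ
      = ⨅ μ ∈ U, energy V W μ := by
  refine le_antisymm (le_iInf₂ fun μ hμ => ?_) (biInf_mono fun μ hμ => hμ.1)
  rcases eq_or_ne (energy V W μ) ⊤ with htop | htop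
  · rw [htop]; exact le_top
  · obtain ⟨νs, hac, hlim, hen⟩ := h4 μ htop.lt_top
    -- The approximants from (H4) eventually lie in the open set `U`, and their energies converge.
    refine ge_of_tendsto hen ?_
    filter_upwards [hlim.eventually (hU.mem_nhds hμ)] with n hn
    exact iInf₂_le (νs n) ⟨hn, hac n⟩

/-! ### The large deviations principle -/

namespace Confined

section LargeDeviations

variable {β : ℕ → ℝ}

/-- Positivity is the lower bound of the Gibbs mass with `A` the whole space, around a measure of
finite energy. -/
theorem eventually_partitionFn (h : Confined V W m b κ) (hd : 1 ≤ d) (hpos : ∀ N, 0 < β N)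
    (hβ : Tendsto (fun N : ℕ => (N : ℝ) / β N) atTop (𝓝 0)) :
    ∀ᶠ N in atTop, 0 < partitionFn V W (β N) N ∧ partitionFn V W (β N) N < ⊤ := by
  obtain ⟨μ, hac, hμ⟩ := h.exists_energy_lt_top hd
  obtain ⟨k, hk, -⟩ := EReal.lt_iff_exists_real_btwn.1 hμ
  obtain ⟨ν, -, hνk, ⟨B, hB0, hB⟩, R, hR⟩ := h.exists_bounded_density hac hk univ_mem
  obtain ⟨p, hp, hpN⟩ := h.exists_le_lintegral_weight hB0 hB hR hνk hpos
    (A := Set.univ) univ_mem (@MeasurableSet.univ _ (borel (Prob d)))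
  filter_upwards [hpN, eventually_ne_atTop 0, hβ.eventually (gt_mem_nhds h.κ_pos)] with N h1 h2 h3
  refine ⟨?_, h.partitionFn_lt_top h2 ?_⟩
  · simp only [Set.mem_univ, Set.ofPred_true, Measure.restrict_univ] at h1
    exact lt_of_lt_of_le (ENNReal.ofReal_pos.2 (Real.exp_pos _)) h1
  · rw [div_lt_iff₀ (hpos N)] at h3
    rw [div_le_iff₀ h.κ_pos]
    linarith

theorem eventuallyEq_log_lintegral (h : Confined V W m b κ) (hd : 1 ≤ d) (hpos : ∀ N, 0 < β N)
    (hβ : Tendsto (fun N : ℕ => (N : ℝ) / β N) atTop (𝓝 0)) {A : Set (Prob d)}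
    (hA : MeasurableSet[borel (Prob d)] A) :
    (fun N : ℕ => ENNReal.log (partitionFn V W (β N) N * empiricalProb V W (β N) N A)
        / (β N : EReal)) =ᶠ[atTop]
      fun N : ℕ => ENNReal.log (∫⁻ x in {x : Fin N → Space d | empirical x ∈ A},
        weight V W (β N) N x) / (β N : EReal) := by
  filter_upwards [h.eventually_partitionFn hd hpos hβ] with N hN
  rw [partitionFn_mul_empiricalProb hN.1 hN.2 hA]

theorem limsup_log_le (h : Confined V W m b κ) (hd : 1 ≤ d) (hpos : ∀ N, 0 < β N)
    (hβ : Tendsto (fun N : ℕ => (N : ℝ) / β N) atTop (𝓝 0)) {A : Set (Prob d)}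
    (hA : MeasurableSet[borel (Prob d)] A) :
    limsup (fun N : ℕ => ENNReal.log (partitionFn V W (β N) N * empiricalProb V W (β N) N A)
        / (β N : EReal)) atTop ≤ -(⨅ μ ∈ closure A, energy V W μ) := by
  rw [limsup_congr (h.eventuallyEq_log_lintegral hd hpos hβ hA)]
  exact h.limsup_lintegral_weight_le hpos hβ hA

theorem le_liminf_log (h : Confined V W m b κ) (hd : 1 ≤ d) (hpos : ∀ N, 0 < β N)
    (hβ : Tendsto (fun N : ℕ => (N : ℝ) / β N) atTop (𝓝 0)) {A : Set (Prob d)}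
    (hA : MeasurableSet[borel (Prob d)] A) :
    -(⨅ μ ∈ {μ : Prob d | μ ∈ interior A ∧ (μ : Measure (Space d)) ≪ volume}, energy V W μ)
      ≤ liminf (fun N : ℕ => ENNReal.log (partitionFn V W (β N) N * empiricalProb V W (β N) N A)
        / (β N : EReal)) atTop := by
  rw [liminf_congr (h.eventuallyEq_log_lintegral hd hpos hβ hA)]
  exact h.le_liminf_lintegral_weight hpos hβ hA

theorem tendsto_log_partitionFn (h : Confined V W m b κ) (hpos : ∀ N, 0 < β N)
    (hβ : Tendsto (fun N : ℕ => (N : ℝ) / β N) atTop (𝓝 0)) (h4 : H4 V W) :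
    Tendsto (fun N : ℕ => ENNReal.log (partitionFn V W (β N) N) / (β N : EReal)) atTop
      (𝓝 (-(⨅ μ : Prob d, energy V W μ))) := by
  have hm := @MeasurableSet.univ _ (borel (Prob d))
  have h1 := h.limsup_lintegral_weight_le hpos hβ hm
  have h2 := h.le_liminf_lintegral_weight hpos hβ hm
  rw [interior_univ, iInf_absolutelyContinuous_eq h4 isOpen_univ] at h2
  simp only [closure_univ, Set.mem_univ, Set.ofPred_true, Measure.restrict_univ, iInf_true]
    at h1 h2
  exact tendsto_of_le_liminf_of_limsup_le h2 h1

theorem log_empiricalProb_eventuallyEq (h : Confined V W m b κ) (hd : 1 ≤ d) (hpos : ∀ N, 0 < β N)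
    (hβ : Tendsto (fun N : ℕ => (N : ℝ) / β N) atTop (𝓝 0)) {A : Set (Prob d)}
    (hA : MeasurableSet[borel (Prob d)] A) :
    (fun N : ℕ => ENNReal.log (empiricalProb V W (β N) N A) / (β N : EReal)) =ᶠ[atTop]
      (fun N : ℕ => ENNReal.log (partitionFn V W (β N) N * empiricalProb V W (β N) N A)
        / (β N : EReal)) + fun N : ℕ => -(ENNReal.log (partitionFn V W (β N) N) / (β N : EReal)) := by
  filter_upwards [h.eventually_partitionFn hd hpos hβ] with N hN
  exact log_empiricalProb_div (hpos N) hN.1 hN.2 hA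

theorem tendsto_neg_log_partitionFn (h : Confined V W m b κ) (hpos : ∀ N, 0 < β N)
    (hβ : Tendsto (fun N : ℕ => (N : ℝ) / β N) atTop (𝓝 0)) (h4 : H4 V W)
    {i₀ : ℝ} (hi : ⨅ μ : Prob d, energy V W μ = (i₀ : EReal)) :
    Tendsto (fun N : ℕ => -(ENNReal.log (partitionFn V W (β N) N) / (β N : EReal))) atTop
      (𝓝 (i₀ : EReal)) := by
  have := (continuous_neg.tendsto _).comp (h.tendsto_log_partitionFn hpos hβ h4)
  rwa [neg_neg, hi] at this

theorem limsup_log_empiricalProb_le (h : Confined V W m b κ) (hd : 1 ≤ d) (hpos : ∀ N, 0 < β N)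
    (hβ : Tendsto (fun N : ℕ => (N : ℝ) / β N) atTop (𝓝 0)) (h4 : H4 V W) {A : Set (Prob d)}
    (hA : MeasurableSet[borel (Prob d)] A) :
    limsup (fun N : ℕ => ENNReal.log (empiricalProb V W (β N) N A) / (β N : EReal)) atTop
      ≤ -(⨅ μ ∈ closure A, rate V W μ) := by
  obtain ⟨i₀, hi⟩ := h.exists_iInf_energy_eq hd
  have hz := (h.tendsto_neg_log_partitionFn hpos hβ h4 hi).limsup_eq
  rw [limsup_congr (h.log_empiricalProb_eventuallyEq hd hpos hβ hA)]
  -- The normalizing term has the finite limit `i₀`, so no `∞ - ∞` can arise.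
  refine (EReal.limsup_add_le (Or.inr (by rw [hz]; exact EReal.coe_ne_top _))
    (Or.inr (by rw [hz]; exact EReal.coe_ne_bot _))).trans ?_
  rw [hz]
  refine (add_le_add (h.limsup_log_le hd hpos hβ hA) le_rfl).trans ?_
  have h1 : (⨅ μ ∈ closure A, rate V W μ) + (i₀ : EReal) ≤ ⨅ μ ∈ closure A, energy V W μ := by
    refine le_iInf₂ fun μ hμ => ?_
    rw [← rate_add hi μ]
    exact add_le_add (iInf₂_le μ hμ) le_rfl
  have h2 := EReal.neg_le_neg_iff.2 h1
  rw [EReal.neg_add (Or.inr (EReal.coe_ne_top _)) (Or.inr (EReal.coe_ne_bot _))] at h2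
  refine (add_le_add h2 le_rfl).trans (le_of_eq ?_)
  exact EReal.sub_add_cancel

theorem le_liminf_log_empiricalProb (h : Confined V W m b κ) (hd : 1 ≤ d) (hpos : ∀ N, 0 < β N)
    (hβ : Tendsto (fun N : ℕ => (N : ℝ) / β N) atTop (𝓝 0)) (h4 : H4 V W) {A : Set (Prob d)}
    (hA : MeasurableSet[borel (Prob d)] A) :
    -(⨅ μ ∈ interior A, rate V W μ)
      ≤ liminf (fun N : ℕ => ENNReal.log (empiricalProb V W (β N) N A) / (β N : EReal)) atTop := by
  obtain ⟨i₀, hi⟩ := h.exists_iInf_energy_eq hd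
  have hz := (h.tendsto_neg_log_partitionFn hpos hβ h4 hi).liminf_eq
  rw [liminf_congr (h.log_empiricalProb_eventuallyEq hd hpos hβ hA)]
  refine le_trans ?_ EReal.le_liminf_add
  rw [hz]
  refine le_trans ?_ (add_le_add (h.le_liminf_log hd hpos hβ hA) le_rfl)
  rw [iInf_absolutelyContinuous_eq h4 isOpen_interior]
  have h1 : (⨅ μ ∈ interior A, energy V W μ) - (i₀ : EReal) ≤ ⨅ μ ∈ interior A, rate V W μ := by
    refine le_iInf₂ fun μ hμ => ?_
    rw [rate, hi]
    exact EReal.sub_le_sub (iInf₂_le μ hμ) le_rfl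
  have h2 := EReal.neg_le_neg_iff.2 h1
  rwa [EReal.neg_sub (Or.inr (EReal.coe_ne_bot _)) (Or.inr (EReal.coe_ne_top _))] at h2

/-! ### Minimizers and almost sure convergence -/

theorem minimizers_nonempty (h : Confined V W m b κ) (hd : 1 ≤ d) :
    (minimizers V W).Nonempty := by
  obtain ⟨i₀, hi⟩ := h.exists_iInf_energy_eq hd
  obtain ⟨μ₀, -, hμ₀⟩ := h.exists_energy_lt_top hd
  obtain ⟨μ, -, hμ⟩ := h.exists_isMin isClosed_univ (Set.mem_univ μ₀) hμ₀
  refine ⟨μ, (rate_eq_zero_iff hi μ).2 ?_⟩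
  rw [← hi]
  exact le_antisymm (le_iInf fun ν => hμ ν (Set.mem_univ ν)) (iInf_le _ μ)

/-- If the energy is finite somewhere on `F`, it attains its minimum there, at a non-minimizer of
the global problem, so the inequality is strict. Otherwise, and for empty `F`, the infimum is `⊤`.
-/
theorem iInf_rate_pos (h : Confined V W m b κ) (hd : 1 ≤ d) {F : Set (Prob d)} (hF : IsClosed F)
    (hdisj : ∀ μ ∈ F, μ ∉ minimizers V W) : 0 < ⨅ μ ∈ F, rate V W μ := by
  obtain ⟨i₀, hi⟩ := h.exists_iInf_energy_eq hd
  by_cases hfin : ∃ μ₀ ∈ F, energy V W μ₀ < ⊤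
  · obtain ⟨μ₀, hμ₀, hlt⟩ := hfin
    obtain ⟨μ, hμF, hμ⟩ := h.exists_isMin hF hμ₀ hlt
    have hgt : (i₀ : EReal) < energy V W μ := by
      refine lt_of_le_of_ne (hi ▸ iInf_le _ μ) fun heq => ?_
      exact hdisj μ hμF ((rate_eq_zero_iff hi μ).2 heq.symm)
    refine (EReal.sub_pos.2 hgt).trans_le (le_iInf₂ fun ν hν => ?_)
    rw [rate, hi]
    exact EReal.sub_le_sub (hμ ν hν) le_rfl
  · push Not at hfin
    refine lt_of_lt_of_le EReal.zero_lt_top (le_iInf₂ fun ν hν => ?_)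
    rw [rate, hi, top_le_iff.1 (hfin ν hν), EReal.top_sub_coe]

/-- Closed sets without minimizers have exponentially small probability. -/
theorem exists_empiricalProb_le (h : Confined V W m b κ) (hd : 1 ≤ d) (hpos : ∀ N, 0 < β N)
    (hβ : Tendsto (fun N : ℕ => (N : ℝ) / β N) atTop (𝓝 0)) (h4 : H4 V W) {F : Set (Prob d)}
    (hF : IsClosed F) (hdisj : ∀ μ ∈ F, μ ∉ minimizers V W) :
    ∃ c : ℝ, 0 < c ∧ ∀ᶠ N in atTop,
      empiricalProb V W (β N) N F ≤ ENNReal.ofReal (Real.exp (-(c * β N))) := by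
  have hFm : MeasurableSet[borel (Prob d)] F := by
    borelize (Prob d)
    exact hF.measurableSet
  obtain ⟨c, hc0, hc⟩ := EReal.lt_iff_exists_real_btwn.1 (h.iInf_rate_pos hd hF hdisj)
  refine ⟨c, by exact_mod_cast hc0, ?_⟩
  have h1 := h.limsup_log_empiricalProb_le hd hpos hβ h4 hFm
  rw [hF.closure_eq] at h1
  have h2 := h1.trans_lt (EReal.neg_lt_neg_iff.2 hc)
  filter_upwards [eventually_lt_of_limsup_lt h2] with N hN
  have hβ' : (0 : EReal) < β N := by exact_mod_cast hpos N
  rw [EReal.div_lt_iff hβ' (EReal.coe_ne_top _), ← EReal.coe_neg, ← EReal.coe_mul] at hN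
  have h3 := EReal.exp_monotone hN.le
  rwa [ENNReal.exp_log, EReal.exp_coe, neg_mul] at h3

/-- The first Borel–Cantelli lemma needs no independence, hence the arbitrary coupling. It is
applied for each radius `1/(n + 1)`, and countably many null sets are discarded. -/
theorem ae_tendsto_dFMSet (h : Confined V W m b κ) (hd : 1 ≤ d) (hpos : ∀ N, 0 < β N)
    (hβ : Tendsto (fun N : ℕ => β N / ((N : ℝ) * Real.log N)) atTop atTop) (h4 : H4 V W)
    {Ω : Type*} [MeasurableSpace Ω] (ℙ : Measure Ω) [IsProbabilityMeasure ℙ]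
    (μ : ℕ → Ω → Prob d)
    (hlaw : ∀ᶠ N in atTop, ∀ A : Set (Prob d), MeasurableSet[borel (Prob d)] A →
      ℙ {ω | μ N ω ∈ A} = empiricalProb V W (β N) N A) :
    ∀ᵐ ω ∂ℙ, Tendsto (fun N => dFMSet (μ N ω) (minimizers V W)) atTop (𝓝 0) := by
  have hβ' := tendsto_div_of_mul_log hβ hpos
  have key : ∀ n : ℕ, ∀ᵐ ω ∂ℙ, ∀ᶠ N in atTop,
      dFMSet (μ N ω) (minimizers V W) < 1 / ((n : ℝ) + 1) := by
    intro n
    have hε : (0 : ℝ) < 1 / ((n : ℝ) + 1) := Nat.one_div_pos_of_nat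
    -- Taking the interior makes the complement closed, hence measurable, without continuity of
    -- `dFMSet`; minimizers stay in it by `dFM_lt_mem_nhds`.
    set U : Set (Prob d) := interior {ν | dFMSet ν (minimizers V W) < 1 / ((n : ℝ) + 1)} with hU
    have hdisj : ∀ ν ∈ Uᶜ, ν ∉ minimizers V W := by
      intro ν hν hmin
      refine hν (mem_interior_iff_mem_nhds.2 ?_)
      filter_upwards [dFM_lt_mem_nhds ν hε] with ρ hρ
      exact (dFMSet_le hmin).trans_lt hρ
    have hF : IsClosed Uᶜ := isOpen_interior.isClosed_compl
    have hFm : MeasurableSet[borel (Prob d)] Uᶜ := by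
      borelize (Prob d)
      exact hF.measurableSet
    obtain ⟨c, hc, hcN⟩ := h.exists_empiricalProb_le hd hpos hβ' h4 hF hdisj
    have hev : ∀ᶠ N : ℕ in atTop, ℙ {ω | μ N ω ∈ Uᶜ} ≤ ENNReal.ofReal (1 / (N : ℝ) ^ 2) := by
      filter_upwards [hcN, hlaw, eventually_exp_neg_le hβ hc] with N h1 h2 h3
      rw [h2 _ hFm]
      exact h1.trans (ENNReal.ofReal_le_ofReal h3)
    obtain ⟨N₀, hN₀⟩ := eventually_atTop.1 hev
    -- The laws are only prescribed for large `N`, hence the shift by `N₀`.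
    have hsum : ∑' N, ℙ {ω | μ (N + N₀) ω ∈ Uᶜ} ≠ ⊤ := by
      have hs : Summable fun N : ℕ => 1 / (((N + N₀ : ℕ) : ℝ)) ^ 2 :=
        (summable_nat_add_iff N₀).2 (Real.summable_one_div_nat_pow.2 one_lt_two)
      refine ne_top_of_le_ne_top hs.tsum_ofReal_ne_top
        (ENNReal.tsum_le_tsum fun N => hN₀ _ (Nat.le_add_left _ _))
    filter_upwards [ae_eventually_notMem hsum] with ω hω
    have h5 : ∀ᶠ N in atTop, μ (N + N₀) ω ∈ U := by
      filter_upwards [hω] with N hN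
      exact not_not.1 hN
    have h6 : ∀ᶠ N in atTop, μ N ω ∈ U :=
      ((tendsto_sub_atTop_nat N₀).eventually h5).and (eventually_ge_atTop N₀) |>.mono
        fun N hN => by rw [Nat.sub_add_cancel hN.2] at hN; exact hN.1
    filter_upwards [h6] with N hN
    have h7 : μ N ω ∈ {ν | dFMSet ν (minimizers V W) < 1 / ((n : ℝ) + 1)} := interior_subset hN
    exact h7
  filter_upwards [ae_all_iff.2 key] with ω hω
  rw [Metric.tendsto_nhds]
  intro ε hε
  obtain ⟨n, hn⟩ := exists_nat_one_div_lt hε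
  filter_upwards [hω n] with N hN
  rw [Real.dist_0_eq_abs, abs_of_nonneg (dFMSet_nonneg _ _)]
  exact hN.trans hn

end LargeDeviations

end Confined

end ParticleGas

theorem theorem1p1 (d : ℕ) (hd : 1 ≤ d)
    (V : ParticleGas.Space d → ℝ) (W : ParticleGas.Space d → ParticleGas.Space d → EReal)
    (β : ℕ → ℝ) (hβ_pos : ∀ N, 0 < β N)
    (hβ : Tendsto (fun N : ℕ => β N / ((N : ℝ) * Real.log N)) atTop atTop)
    (h1 : ParticleGas.H1 W) (h2 : ParticleGas.H2 V) (h3 : ParticleGas.H3 V W) :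
    -- the Gibbs measures are well defined for large `N`
    (∀ᶠ N in atTop, 0 < ParticleGas.partitionFn V W (β N) N ∧
      ParticleGas.partitionFn V W (β N) N < ⊤ ∧
      IsProbabilityMeasure (ParticleGas.gibbs V W (β N) N)) ∧
    -- properties of the rate function
    ((∀ k : ℝ, IsCompact {μ : ParticleGas.Prob d | ParticleGas.energy V W μ ≤ (k : EReal)}) ∧
      LowerSemicontinuous (ParticleGas.energy V W) ∧
      ⊥ < ⨅ μ : ParticleGas.Prob d, ParticleGas.energy V W μ) ∧
    -- upper bound, and lower bound restricted to absolutely continuous measures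
    (∀ A : Set (ParticleGas.Prob d), MeasurableSet[borel (ParticleGas.Prob d)] A →
      limsup (fun N : ℕ => ENNReal.log (ParticleGas.partitionFn V W (β N) N *
          ParticleGas.empiricalProb V W (β N) N A) / (β N : EReal)) atTop
        ≤ -(⨅ μ ∈ closure A, ParticleGas.energy V W μ) ∧
      -(⨅ μ ∈ {μ : ParticleGas.Prob d | μ ∈ interior A ∧
            (μ : Measure (ParticleGas.Space d)) ≪ volume}, ParticleGas.energy V W μ)
        ≤ liminf (fun N : ℕ => ENNReal.log (ParticleGas.partitionFn V W (β N) N *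
          ParticleGas.empiricalProb V W (β N) N A) / (β N : EReal)) atTop) ∧
    -- full large deviations principle and asymptotics of `log Z_N`
    (ParticleGas.H4 V W →
      (∀ A : Set (ParticleGas.Prob d), MeasurableSet[borel (ParticleGas.Prob d)] A →
        -(⨅ μ ∈ interior A, ParticleGas.rate V W μ)
          ≤ liminf (fun N : ℕ => ENNReal.log (ParticleGas.empiricalProb V W (β N) N A)
              / (β N : EReal)) atTop ∧
        liminf (fun N : ℕ => ENNReal.log (ParticleGas.empiricalProb V W (β N) N A)
              / (β N : EReal)) atTop
          ≤ limsup (fun N : ℕ => ENNReal.log (ParticleGas.empiricalProb V W (β N) N A)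
              / (β N : EReal)) atTop ∧
        limsup (fun N : ℕ => ENNReal.log (ParticleGas.empiricalProb V W (β N) N A)
              / (β N : EReal)) atTop
          ≤ -(⨅ μ ∈ closure A, ParticleGas.rate V W μ)) ∧
      Tendsto (fun N : ℕ => ENNReal.log (ParticleGas.partitionFn V W (β N) N) / (β N : EReal))
        atTop (𝓝 (-(⨅ μ : ParticleGas.Prob d, ParticleGas.energy V W μ)))) ∧
    -- minimizers and almost sure convergence
    ((ParticleGas.minimizers V W).Nonempty ∧
      (ParticleGas.H4 V W →
        ∀ (Ω : Type*) [MeasurableSpace Ω] (ℙ : Measure Ω) [IsProbabilityMeasure ℙ]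
          (μ : ℕ → Ω → ParticleGas.Prob d),
          (∀ N, @Measurable Ω (ParticleGas.Prob d) _ (borel (ParticleGas.Prob d)) (μ N)) →
          (∀ᶠ N in atTop, ∀ A : Set (ParticleGas.Prob d),
            MeasurableSet[borel (ParticleGas.Prob d)] A →
              ℙ {ω | μ N ω ∈ A} = ParticleGas.empiricalProb V W (β N) N A) →
          ∀ᵐ ω ∂ℙ, Tendsto
            (fun N => ParticleGas.dFMSet (μ N ω) (ParticleGas.minimizers V W)) atTop (𝓝 0))) := by
  obtain ⟨m, b, κ, h⟩ := ParticleGas.exists_confined h1 h2 h3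
  have hβ' := ParticleGas.tendsto_div_of_mul_log hβ hβ_pos
  refine ⟨?_, ⟨h.isCompact_sublevel, h.lowerSemicontinuous_energy, h.bot_lt_iInf_energy⟩,
    fun A hA => ⟨h.limsup_log_le hd hβ_pos hβ' hA, h.le_liminf_log hd hβ_pos hβ' hA⟩,
    fun h4 => ⟨fun A hA => ⟨h.le_liminf_log_empiricalProb hd hβ_pos hβ' h4 hA, liminf_le_limsup,
      h.limsup_log_empiricalProb_le hd hβ_pos hβ' h4 hA⟩, h.tendsto_log_partitionFn hβ_pos hβ' h4⟩,
    h.minimizers_nonempty hd, fun h4 Ω _ ℙ _ μ _ hlaw =>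
      h.ae_tendsto_dFMSet hd hβ_pos hβ h4 ℙ μ hlaw⟩
  filter_upwards [h.eventually_partitionFn hd hβ_pos hβ'] with N hN
  exact ⟨hN.1, hN.2, ParticleGas.isProbabilityMeasure_gibbs hN.1 hN.2⟩
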